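/- Setting. There are $n\ge 1$ machines; machine $v$ holds a vector $x_v\in\mathbb R^d$, and all machines know $n$, $d$, $q$ and a number $y\ge 0$ with $\|x_u-x_v\|_2\le y$ for all $u,v$. The inputs are otherwise arbitrary. The machines communicate in synchronous rounds, in which any machine may send any finite (possibly empty) bit string to any machine, and they have access to a common random string. What a machine does is determined by the common random string, its own input and the string of bits that it has received so far (and, when sending, the round number). The communication of a machine is the total number of bits that it sends and receives. A protocol performs MeanEstimation with output variance at most $V$ if, for all such inputs, all machines almost surely output the same random vector $\mathrm{EST}$, with $\mathbb E[\mathrm{EST}]=\mu:=\frac1n\sum_v x_v$ and $\mathbb E\|\mathrm{EST}-\mu\|_2^2\le V$. Theorem. There is an absolute constant $C>0$ such that for all integers $n\ge 1$, $d\ge 0$ and all real $q>0$, $y\ge 0$ there is a protocol (depending on $n,d,q,y$ but not on the inputs) that performs MeanEstimation with output variance at most $C\,y^2/q^2$ and in which, for all admissible inputs, the expected number of bits communicated by each machine is at most $C\,d\log_2(1+q)$; in particular (after enlarging the constant) it is at most $C\,d\,q$, which is sublinear in $d$ when $q=o(1)$. -/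

import Mathlib

open MeasureTheory

/-- A (randomized) synchronous message-passing protocol for `n` machines, each holding one private
input vector in `ℝ^d` (with the `ℓ₂` norm). All machines have access to a common random string
`ω`, drawn from the distribution `law`.

In every round each machine may send an arbitrary finite bit string to every machine. What a
machine does depends only on the shared randomness, on its own input, and on the string of bits
that it has received so far (plus, for sending, the number of the current round). In particular
the output of a machine is a function of the shared randomness, its own input and the string of
bits it received: no information is conveyed for free by the timing of messages or by the identity
of their senders. Sending the empty string is the same as sending nothing. -/
structure Protocol (n d : ℕ) where
  /-- The space of shared random strings. -/
  Ω : Type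
  [measurableSpace : MeasurableSpace Ω]
  /-- The distribution of the shared random string. -/
  law : Measure Ω
  [isProbabilityMeasure : IsProbabilityMeasure law]
  /-- The number of communication rounds. -/
  rounds : ℕ
  /-- `send r u ω a s v` is the bit string sent in round `r` by machine `u` to machine `v`, when
  the shared randomness is `ω`, the input of `u` is `a` and `u` has received the string `s` in the
  rounds before `r`. -/
  send : ℕ → Fin n → Ω → EuclideanSpace ℝ (Fin d) → List Bool → Fin n → List Bool
  /-- `output v ω a s` is the output of machine `v`, when the shared randomness is `ω`, the input
  of `v` is `a` and `v` has received the string `s` during the whole execution. -/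
  output : Fin n → Ω → EuclideanSpace ℝ (Fin d) → List Bool → EuclideanSpace ℝ (Fin d)
  /-- Messages are measurable functions of the shared randomness. -/
  measurableSet_send : ∀ (r : ℕ) (u : Fin n) (a : EuclideanSpace ℝ (Fin d)) (s : List Bool)
    (v : Fin n) (m : List Bool), MeasurableSet {ω | send r u ω a s v = m}
  /-- Outputs are measurable functions of the shared randomness. -/
  measurable_output : ∀ (v : Fin n) (a : EuclideanSpace ℝ (Fin d)) (s : List Bool),
    Measurable fun ω => output v ω a s

namespace Protocol

attribute [instance] Protocol.measurableSpace Protocol.isProbabilityMeasure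

variable {n d : ℕ} (P : Protocol n d) (x : Fin n → EuclideanSpace ℝ (Fin d)) (ω : P.Ω)

/-- The string of bits that machine `v` has received in the rounds `0, …, r - 1`, when the inputs
are `x` and the shared randomness is `ω`: in each round the messages addressed to `v` are appended
to its string, in the order of their senders. -/
def received : ℕ → Fin n → List Bool
  | 0, _ => []
  | r + 1, v => received r v ++
      (List.finRange n).flatMap fun u => P.send r u ω (x u) (received r u) v

/-- The total number of bits sent by machine `v` during the execution. -/
def sentBits (v : Fin n) : ℕ :=
  ∑ r ∈ Finset.range P.rounds, ∑ u : Fin n,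
    (P.send r v ω (x v) (P.received x ω r v) u).length

/-- The total number of bits sent and received by machine `v` during the execution. -/
def bits (v : Fin n) : ℕ :=
  P.sentBits x ω v + (P.received x ω P.rounds v).length

/-- The output of machine `v` at the end of the execution. -/
def out (v : Fin n) : EuclideanSpace ℝ (Fin d) :=
  P.output v ω (x v) (P.received x ω P.rounds v)

/-- `P` performs mean estimation for inputs at pairwise distance at most `y`, with output variance
at most `V`: for every such family of inputs, all machines output (almost surely) the same vector,
which is an unbiased estimator of the mean of the inputs and has variance at most `V`. -/
def PerformsMeanEstimation (y V : ℝ) : Prop :=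
  ∀ x : Fin n → EuclideanSpace ℝ (Fin d), (∀ u v, ‖x u - x v‖ ≤ y) →
    (∀ᵐ ω ∂P.law, ∀ u v, P.out x ω u = P.out x ω v) ∧
    ∀ v, Integrable (fun ω => P.out x ω v) P.law ∧
      ∫ ω, P.out x ω v ∂P.law = (n : ℝ)⁻¹ • ∑ u, x u ∧
      ∫⁻ ω, ‖P.out x ω v - (n : ℝ)⁻¹ • ∑ u, x u‖ₑ ^ 2 ∂P.law ≤ ENNReal.ofReal V

/-- For all inputs at pairwise distance at most `y`, every machine sends and receives at most `b`
bits in total, in expectation. -/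
def ExpectedBitsLE (y b : ℝ) : Prop :=
  ∀ x : Fin n → EuclideanSpace ℝ (Fin d), (∀ u v, ‖x u - x v‖ ≤ y) →
    ∀ v, ∫⁻ ω, (P.bits x ω v : ENNReal) ∂P.law ≤ ENNReal.ofReal b

end Protocol

/-! The core is a quantizer with shared randomness whose expected message length is `O(d log₂(1 +
2δ/r))`, with no additive constant. The shared string contains independent uniform shifts of the
lattice `L • ℤ^d`. A point `x` is moved to the nearby point of the first shifted lattice that comes
within `r` of it. With `L` large compared to the radii, the displacement given a hit is uniform in
the ball of radius `r`, so the quantization is unbiased with error at most `r`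
(`map_apply_firstHit_restrict`, `integral_torusLift_eq_zero`).

The index of that lattice is sent as a prefix of its random hash. A receiver knowing `x` up to `δ`
can confuse it only with earlier indices whose point is within `r + 2δ` of `x`. A ratio of ball
volumes bounds their expected number by `(1 + 2δ/r)^d - 1` (`lintegral_card_before_firstHit_le`).
Separating the index from `M` rivals takes `O(log₂(1 + M))` expected bits, and none if `M = 0`
(`lintegral_hashLength_le`). Concavity of the logarithm then gives the claimed length, and
`ballDec_ballEnc` gives correctness of the decoding.

For mean estimation, a uniformly random leader broadcasts a quantization with `r = y/q`.
Broadcasting to `n` machines costs a factor `n`, but a machine is the leader with probability `1/n`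
only. If `q ≤ 1`, the leader quantizes its own input: it is unbiased because the leader is random,
and its error `y` is at most `y/q`. If `q > 1`, all machines first send quantized inputs to the
leader, who averages the decoded points and quantizes the average again. Framing these messages
costs an extra bit each, which is affordable since `d log₂(1 + q) ≥ 1`. -/

/-! ### The torus and its lift to Euclidean space -/

/-- The projection of `ℝ^d` to the torus `(ℝ/ℤ)^d`. -/
noncomputable def torusProj {d : ℕ} (x : EuclideanSpace ℝ (Fin d)) : Fin d → UnitAddCircle :=
  fun j => (x j : UnitAddCircle)

/-- The representative of a point of the torus in the cube `(-1/2, 1/2]^d`. -/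
noncomputable def torusLift {d : ℕ} (t : Fin d → UnitAddCircle) : EuclideanSpace ℝ (Fin d) :=
  WithLp.toLp 2 fun j => (AddCircle.equivIoc 1 (-1 / 2 : ℝ) (t j) : ℝ)

theorem torusProj_torusLift {d : ℕ} (t : Fin d → UnitAddCircle) : torusProj (torusLift t) = t := by
  funext j
  exact AddCircle.coe_equivIoc

theorem mem_Ioc_of_norm_lt {d : ℕ} {x : EuclideanSpace ℝ (Fin d)} (hx : ‖x‖ < 1 / 2) (j : Fin d) :
    x j ∈ Set.Ioc (-1 / 2 : ℝ) (-1 / 2 + 1) := by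
  have h := (PiLp.norm_apply_le x j).trans_lt hx
  rw [Real.norm_eq_abs, abs_lt] at h
  constructor <;> linarith [h.1, h.2]

theorem torusLift_torusProj_of_mem {d : ℕ} {x : EuclideanSpace ℝ (Fin d)}
    (hx : ∀ j, x j ∈ Set.Ioc (-1 / 2 : ℝ) (-1 / 2 + 1)) : torusLift (torusProj x) = x := by
  ext j
  simp only [torusLift, torusProj]
  rw [AddCircle.equivIoc_coe_eq (hx j)]

theorem torusLift_torusProj {d : ℕ} {x : EuclideanSpace ℝ (Fin d)} (hx : ‖x‖ < 1 / 2) :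
    torusLift (torusProj x) = x :=
  torusLift_torusProj_of_mem (mem_Ioc_of_norm_lt hx)

theorem torusProj_sub {d : ℕ} (x y : EuclideanSpace ℝ (Fin d)) :
    torusProj (x - y) = torusProj x - torusProj y := by
  funext j
  simp [torusProj]

theorem measurable_torusLift {d : ℕ} :
    Measurable (torusLift : (Fin d → UnitAddCircle) → EuclideanSpace ℝ (Fin d)) := by
  refine (PiLp.continuous_toLp 2 _).measurable.comp (measurable_pi_iff.2 fun j => ?_)
  exact measurable_subtype_coe.comp
    ((AddCircle.measurableEquivIoc (1 : ℝ) (-1 / 2)).measurable.comp (measurable_pi_apply j))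

theorem measurable_torusProj {d : ℕ} :
    Measurable (torusProj : EuclideanSpace ℝ (Fin d) → Fin d → UnitAddCircle) := by
  refine measurable_pi_iff.2 fun j => AddCircle.measurable_mk'.comp ?_
  fun_prop

theorem measurePreserving_torusProj (d : ℕ) :
    MeasurePreserving (torusProj (d := d))
      (volume.restrict {x | ∀ j, x j ∈ Set.Ioc (-1 / 2 : ℝ) (-1 / 2 + 1)}) volume := by
  have h1 := measurePreserving_pi (fun _ : Fin d => volume.restrict (Set.Ioc (-1 / 2 : ℝ) (-1 / 2 + 1)))
    (fun _ => (volume : Measure UnitAddCircle))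
    (fun _ => UnitAddCircle.measurePreserving_mk (-1 / 2))
  rw [← Measure.restrict_pi_pi] at h1
  have h2 := (PiLp.volume_preserving_ofLp (Fin d)).restrict_preimage
    (s := Set.univ.pi fun _ => Set.Ioc (-1 / 2 : ℝ) (-1 / 2 + 1))
    (MeasurableSet.univ_pi fun _ => measurableSet_Ioc)
  have h3 := h1.comp h2
  have hs : (WithLp.ofLp ⁻¹' (Set.univ.pi fun _ : Fin d => Set.Ioc (-1 / 2 : ℝ) (-1 / 2 + 1)))
      = {x : EuclideanSpace ℝ (Fin d) | ∀ j, x j ∈ Set.Ioc (-1 / 2 : ℝ) (-1 / 2 + 1)} := by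
    ext x; simp
  rw [hs] at h3
  exact h3

/-- For `ρ < 1/2` the ball lies inside the fundamental cube, on which the projection preserves
volume. -/
theorem volume_norm_torusLift_le (d : ℕ) {ρ : ℝ} (hρ : ρ < 1 / 2) :
    volume {t : Fin d → UnitAddCircle | ‖torusLift t‖ ≤ ρ}
      = volume (Metric.closedBall (0 : EuclideanSpace ℝ (Fin d)) ρ) := by
  have hm : MeasurableSet {t : Fin d → UnitAddCircle | ‖torusLift t‖ ≤ ρ} :=
    measurable_torusLift.norm measurableSet_Iic
  rw [← (measurePreserving_torusProj d).measure_preimage hm.nullMeasurableSet,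
    Measure.restrict_apply (measurable_torusProj hm)]
  congr 1
  ext x
  simp only [Set.mem_inter_iff, Set.mem_preimage, Set.mem_ofPred_eq, mem_closedBall_zero_iff]
  constructor
  · rintro ⟨h1, h2⟩
    rwa [torusLift_torusProj_of_mem h2] at h1
  · intro h
    have h' := h.trans_lt hρ
    exact ⟨by rwa [torusLift_torusProj h'], mem_Ioc_of_norm_lt h'⟩

/-- The half-open cube is not symmetric, but the ball inside it is: pulled back to `ℝ^d`, the
integrand is the odd function `g`. This is the source of unbiasedness. -/
theorem integral_torusLift_eq_zero (d : ℕ) {ρ : ℝ} (hρ : ρ < 1 / 2) :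
    ∫ t in {t : Fin d → UnitAddCircle | ‖torusLift t‖ ≤ ρ}, torusLift t = 0 := by
  have hm : MeasurableSet {t : Fin d → UnitAddCircle | ‖torusLift t‖ ≤ ρ} :=
    measurable_torusLift.norm measurableSet_Iic
  set f : (Fin d → UnitAddCircle) → EuclideanSpace ℝ (Fin d) :=
    Set.indicator {t | ‖torusLift t‖ ≤ ρ} torusLift with hf
  have hfm : Measurable f := measurable_torusLift.indicator hm
  rw [← integral_indicator hm, ← hf, ← (measurePreserving_torusProj d).map_eq,
    integral_map measurable_torusProj.aemeasurable hfm.aestronglyMeasurable]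
  have hc : MeasurableSet {x : EuclideanSpace ℝ (Fin d) |
      ∀ j, x j ∈ Set.Ioc (-1 / 2 : ℝ) (-1 / 2 + 1)} := by
    rw [Set.ofPred_forall]
    exact MeasurableSet.iInter fun j =>
      (by fun_prop : Measurable fun x : EuclideanSpace ℝ (Fin d) => x j) measurableSet_Ioc
  rw [← integral_indicator hc]
  set g : EuclideanSpace ℝ (Fin d) → EuclideanSpace ℝ (Fin d) :=
    Set.indicator {x | ∀ j, x j ∈ Set.Ioc (-1 / 2 : ℝ) (-1 / 2 + 1)} (fun x => f (torusProj x))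
  have hg : ∀ x, g x = if ‖x‖ ≤ ρ then x else 0 := by
    intro x
    by_cases h : ∀ j, x j ∈ Set.Ioc (-1 / 2 : ℝ) (-1 / 2 + 1)
    · simp only [g, Set.indicator, Set.mem_ofPred_eq, h, hf, torusLift_torusProj_of_mem h]
      simp
    · have : ¬ ‖x‖ ≤ ρ := fun h' => h (mem_Ioc_of_norm_lt (h'.trans_lt hρ))
      simp only [g, Set.indicator, Set.mem_ofPred_eq, h, this, if_false]
  have hodd : ∀ x, g (-x) = -g x := by
    intro x
    rw [hg, hg, norm_neg]
    split_ifs <;> simp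
  have h1 := integral_neg_eq_self g volume
  simp only [hodd, integral_neg] at h1
  have h2 : (2 : ℝ) • ∫ x, g x = 0 := by
    rw [two_smul]
    nth_rewrite 1 [← h1]
    exact neg_add_cancel _
  exact (smul_eq_zero.1 h2).resolve_left two_ne_zero

/-! ### Randomly shifted lattices -/

/-- The displacement from `x` to the nearby point of the shifted lattice `L • (t + ℤ^d)`. -/
noncomputable def displacement {d : ℕ} (L : ℝ) (t : Fin d → UnitAddCircle)
    (x : EuclideanSpace ℝ (Fin d)) : EuclideanSpace ℝ (Fin d) :=
  L • torusLift (t - torusProj (L⁻¹ • x))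

theorem measurable_displacement {d : ℕ} (L : ℝ) :
    Measurable fun p : (Fin d → UnitAddCircle) × EuclideanSpace ℝ (Fin d) =>
      displacement L p.1 p.2 :=
  (measurable_torusLift.comp (measurable_fst.sub
    (measurable_torusProj.comp (measurable_snd.const_smul L⁻¹)))).const_smul L

/-- A vector shorter than `L / 2` is the canonical representative of its class modulo `L • ℤ^d`.
Hence `x` and `x'` select the same lattice point, which is what lets a receiver recover the sender's
point from its own input. -/
theorem displacement_eq_add {d : ℕ} {L : ℝ} (hL : 0 < L) {t : Fin d → UnitAddCircle}
    {x x' : EuclideanSpace ℝ (Fin d)} (h : ‖displacement L t x + (x - x')‖ < L / 2) :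
    displacement L t x' = displacement L t x + (x - x') := by
  set w := displacement L t x + (x - x') with hw
  have h1 : ‖L⁻¹ • w‖ < 1 / 2 := by
    rw [norm_smul, Real.norm_of_nonneg (inv_nonneg.2 hL.le), inv_mul_lt_iff₀ hL]
    linarith
  have h2 : torusProj (L⁻¹ • w) = t - torusProj (L⁻¹ • x') := by
    have : L⁻¹ • w = torusLift (t - torusProj (L⁻¹ • x)) - (L⁻¹ • x' - L⁻¹ • x) := by
      rw [hw, displacement, smul_add, smul_sub, inv_smul_smul₀ hL.ne']
      abel
    rw [this, torusProj_sub, torusProj_sub, torusProj_torusLift]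
    abel
  rw [displacement, ← h2, torusLift_torusProj h1, smul_inv_smul₀ hL.ne']

theorem norm_displacement_le_iff {d : ℕ} {L : ℝ} (hL : 0 < L) (ρ : ℝ)
    (t : Fin d → UnitAddCircle) (x : EuclideanSpace ℝ (Fin d)) :
    ‖displacement L t x‖ ≤ ρ ↔ ‖torusLift (t - torusProj (L⁻¹ • x))‖ ≤ ρ / L := by
  rw [displacement, norm_smul, Real.norm_of_nonneg hL.le, le_div_iff₀ hL, mul_comm]

/-- Translation invariance on the torus removes `x`. In ratios of such volumes `L` cancels as well,
so only the ratio of the radii matters. -/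
theorem volume_norm_displacement_le {d : ℕ} {L ρ : ℝ} (hL : 0 < L) (hρ₀ : 0 ≤ ρ) (hρ : ρ < L / 2)
    (x : EuclideanSpace ℝ (Fin d)) :
    volume {t : Fin d → UnitAddCircle | ‖displacement L t x‖ ≤ ρ}
      = ENNReal.ofReal ((ρ / L) ^ d)
        * volume (Metric.ball (0 : EuclideanSpace ℝ (Fin d)) 1) := by
  have h : {t : Fin d → UnitAddCircle | ‖displacement L t x‖ ≤ ρ}
      = (fun t => t - torusProj (L⁻¹ • x)) ⁻¹' {t | ‖torusLift t‖ ≤ ρ / L} := by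
    ext t
    exact norm_displacement_le_iff hL ρ t x
  have hm : MeasurableSet {t : Fin d → UnitAddCircle | ‖torusLift t‖ ≤ ρ / L} :=
    measurable_torusLift.norm measurableSet_Iic
  rw [h, (measurePreserving_sub_right volume _).measure_preimage hm.nullMeasurableSet,
    volume_norm_torusLift_le d (by rw [div_lt_iff₀ hL]; linarith),
    Measure.addHaar_closedBall _ _ (by positivity), finrank_euclideanSpace_fin]

theorem integral_displacement_eq_zero {d : ℕ} {L ρ : ℝ} (hL : 0 < L) (hρ : ρ < L / 2)
    (x : EuclideanSpace ℝ (Fin d)) :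
    ∫ t in {t : Fin d → UnitAddCircle | ‖displacement L t x‖ ≤ ρ}, displacement L t x = 0 := by
  have hm : MeasurableSet {t : Fin d → UnitAddCircle | ‖torusLift t‖ ≤ ρ / L} :=
    measurable_torusLift.norm measurableSet_Iic
  have hm' : MeasurableSet {t : Fin d → UnitAddCircle | ‖displacement L t x‖ ≤ ρ} :=
    ((measurable_displacement L).comp measurable_prodMk_right).norm measurableSet_Iic
  have h := integral_sub_right_eq_self (μ := volume)
    (Set.indicator {t : Fin d → UnitAddCircle | ‖torusLift t‖ ≤ ρ / L} fun t => L • torusLift t)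
    (torusProj (L⁻¹ • x))
  rw [integral_indicator hm, integral_smul,
    integral_torusLift_eq_zero d (by rw [div_lt_iff₀ hL]; linarith), smul_zero] at h
  rw [← integral_indicator hm', ← h]
  congr 1
  funext t
  simp only [Set.indicator, Set.mem_ofPred_eq, norm_displacement_le_iff hL]
  rfl

attribute [irreducible] displacement

/-! ### Measurability of first indices -/

theorem measurable_sInf_nat {α : Type*} [MeasurableSpace α] {p : ℕ → α → Prop}
    (hp : ∀ k, Measurable (p k)) : Measurable fun a => sInf {k | p k a} := by
  refine measurable_to_countable' fun k => ?_
  -- The second alternative accounts for `sInf ∅ = 0`.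
  have h : (fun a => sInf {k | p k a}) ⁻¹' {k}
      = {a | (p k a ∧ ∀ j < k, ¬ p j a) ∨ (k = 0 ∧ ∀ j, ¬ p j a)} := by
    ext a
    simp only [Set.mem_preimage, Set.mem_singleton_iff, Set.mem_ofPred_eq]
    constructor
    · rintro rfl
      by_cases he : {k | p k a}.Nonempty
      · exact Or.inl ⟨Nat.sInf_mem he, fun j hj => Nat.notMem_of_lt_sInf hj⟩
      · rw [Set.not_nonempty_iff_eq_empty] at he
        refine Or.inr ⟨by rw [he, Nat.sInf_empty], fun j hj => ?_⟩
        have : j ∈ {k | p k a} := hj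
        rw [he] at this
        exact this
    · rintro (⟨h1, h2⟩ | ⟨rfl, h2⟩)
      · refine le_antisymm (Nat.sInf_le h1) (le_csInf ⟨k, h1⟩ fun j hj => ?_)
        by_contra hlt
        exact h2 j (not_le.1 hlt) hj
      · have : {k | p k a} = ∅ := Set.eq_empty_of_forall_notMem h2
        rw [this, Nat.sInf_empty]
  rw [h]
  exact (((hp k).and (.forall fun j => .imp measurable_const (hp j).not)).or
    (measurable_const.and (.forall fun j => (hp j).not))).setOf

theorem measurable_of_countable_index {α β ι : Type*} [MeasurableSpace α] [MeasurableSpace β]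
    [Countable ι] [MeasurableSpace ι] [MeasurableSingletonClass ι] {i : α → ι} (hi : Measurable i)
    {f : ι → α → β} (hf : ∀ k, Measurable (f k)) : Measurable fun a => f (i a) a :=
  (measurable_from_prod_countable_right (f := fun p : ι × α => f p.1 p.2) hf).comp
    (hi.prodMk measurable_id)

/-! ### The first point of an independent sequence in a given set -/

section FirstHit

variable {T : Type*}

/-- The first index at which the sequence `z` is in `A`. -/
noncomputable def firstHit (A : Set T) (z : ℕ → T) : ℕ := sInf {k | z k ∈ A}

theorem firstHit_mem {A : Set T} {z : ℕ → T} (h : ∃ k, z k ∈ A) : z (firstHit A z) ∈ A :=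
  Nat.sInf_mem (s := {k | z k ∈ A}) h

theorem notMem_of_lt_firstHit {A : Set T} {z : ℕ → T} {k : ℕ} (h : k < firstHit A z) : z k ∉ A :=
  Nat.notMem_of_lt_sInf (s := {k | z k ∈ A}) h

theorem firstHit_eq {A : Set T} {z : ℕ → T} {i : ℕ} (h1 : ∀ k < i, z k ∉ A) (h2 : z i ∈ A) :
    firstHit A z = i := by
  refine le_antisymm (Nat.sInf_le h2) ?_
  by_contra h
  exact h1 _ (not_le.1 h) (firstHit_mem ⟨i, h2⟩)

variable [MeasurableSpace T] (μ : Measure T) [IsProbabilityMeasure μ]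

theorem measurable_firstHit {A : Set T} (hA : MeasurableSet A) :
    Measurable (firstHit A : (ℕ → T) → ℕ) :=
  measurable_sInf_nat fun k => measurableSet_setOfPred.1 (measurable_pi_apply k hA)

theorem measurable_apply_firstHit {A : Set T} (hA : MeasurableSet A) :
    Measurable fun z : ℕ → T => z (firstHit A z) :=
  measurable_of_countable_index (f := fun k z => z k) (measurable_firstHit hA) measurable_pi_apply

theorem measurableSet_avoid_and_mem {A B : Set T} (hA : MeasurableSet A) (hB : MeasurableSet B)
    (i : ℕ) : MeasurableSet {z : ℕ → T | (∀ k < i, z k ∉ A) ∧ z i ∈ B} := by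
  have h : ∀ {S : Set T}, MeasurableSet S → ∀ k, Measurable fun z : ℕ → T => z k ∈ S :=
    fun hS k => measurableSet_setOfPred.1 (measurable_pi_apply k hS)
  exact (Measurable.and (.forall fun k => .imp measurable_const (h hA k).not) (h hB i)).setOf

theorem infinitePi_avoid_and_mem {A B : Set T} (hA : MeasurableSet A) (hB : MeasurableSet B)
    (i : ℕ) :
    Measure.infinitePi (fun _ : ℕ => μ) {z | (∀ k < i, z k ∉ A) ∧ z i ∈ B}
      = (1 - μ A) ^ i * μ B := by
  have h : {z : ℕ → T | (∀ k < i, z k ∉ A) ∧ z i ∈ B}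
      = ((Finset.range (i + 1) : Finset ℕ) : Set ℕ).pi fun k => if k = i then B else Aᶜ := by
    ext z
    simp only [Set.mem_ofPred_eq, Set.mem_pi, Finset.coe_range, Set.mem_Iio]
    constructor
    · rintro ⟨h1, h2⟩ k hk
      split_ifs with hki
      · rwa [hki]
      · exact h1 k (by omega)
    · intro h
      refine ⟨fun k hk => ?_, by simpa using h i (by omega)⟩
      have := h k (by omega)
      rwa [if_neg hk.ne] at this
  rw [h, Measure.infinitePi_pi]
  · rw [Finset.prod_range_succ, if_pos rfl, Finset.prod_congr rfl (g := fun _ => μ Aᶜ),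
      Finset.prod_const, Finset.card_range, prob_compl_eq_one_sub hA]
    intro k hk
    rw [if_neg (Finset.mem_range.1 hk).ne]
  · intro k _
    split_ifs
    exacts [hB, hA.compl]

/-- Sums the geometric law of the first hitting time. The case `a = 0` is included, with `0⁻¹ = ∞`.
-/
theorem tsum_one_sub_pow_mul {a b : ENNReal} (ha : a ≤ 1) :
    ∑' i : ℕ, (1 - a) ^ i * b = a⁻¹ * b := by
  rw [ENNReal.tsum_mul_right, ENNReal.tsum_geometric,
    ENNReal.sub_sub_cancel ENNReal.one_ne_top ha]

theorem infinitePi_exists_avoid_and_mem {A B : Set T} (hA : MeasurableSet A)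
    (hB : MeasurableSet B) (hBA : B ⊆ A) :
    Measure.infinitePi (fun _ : ℕ => μ) {z | ∃ i, (∀ k < i, z k ∉ A) ∧ z i ∈ B}
      = (μ A)⁻¹ * μ B := by
  have hm : ∀ i, MeasurableSet {z : ℕ → T | (∀ k < i, z k ∉ A) ∧ z i ∈ B} :=
    measurableSet_avoid_and_mem hA hB
  rw [Set.ofPred_exists, measure_iUnion _ hm]
  · simp_rw [infinitePi_avoid_and_mem μ hA hB]
    exact tsum_one_sub_pow_mul prob_le_one
  · intro i j hij
    refine Set.disjoint_left.2 ?_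
    rintro z ⟨h1, h2⟩ ⟨h3, h4⟩
    rcases lt_or_gt_of_ne hij with h | h
    · exact h3 i h (hBA h2)
    · exact h1 j h (hBA h4)

theorem ae_exists_mem {A : Set T} (hA : MeasurableSet A) (h0 : μ A ≠ 0) :
    ∀ᵐ z ∂Measure.infinitePi (fun _ : ℕ => μ), ∃ k, z k ∈ A := by
  have h := infinitePi_exists_avoid_and_mem μ hA hA subset_rfl
  rw [ENNReal.inv_mul_cancel h0 (measure_ne_top μ A)] at h
  have hm : MeasurableSet {z : ℕ → T | ∃ k, z k ∈ A} := by
    rw [Set.ofPred_exists]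
    exact MeasurableSet.iUnion fun k => measurable_pi_apply k hA
  refine (prob_compl_eq_zero_iff hm).2 (le_antisymm prob_le_one ?_)
  rw [← h]
  exact measure_mono fun z ⟨i, _, hi⟩ => ⟨i, hi⟩

/-- Rejection sampling: the first sample in `A` has the law `μ` conditioned on `A`. Restricting to
`A` discards the sequences that never hit, for which the index defaults to `0`. -/
theorem map_apply_firstHit_restrict {A : Set T} (hA : MeasurableSet A) :
    ((Measure.infinitePi (fun _ : ℕ => μ)).map fun z => z (firstHit A z)).restrict A
      = (μ A)⁻¹ • μ.restrict A := by
  ext B hB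
  have hBA := hB.inter hA
  rw [Measure.restrict_apply hB, Measure.map_apply (measurable_apply_firstHit hA) hBA,
    Measure.smul_apply, Measure.restrict_apply hB, smul_eq_mul,
    ← infinitePi_exists_avoid_and_mem μ hA hBA Set.inter_subset_right]
  congr 1
  ext z
  constructor
  · exact fun h => ⟨_, fun k hk => notMem_of_lt_firstHit hk, h⟩
  · rintro ⟨i, h1, h2⟩
    rw [Set.mem_preimage, firstHit_eq h1 h2.2]
    exact h2

theorem integral_indicator_apply_firstHit {F : Type*} [NormedAddCommGroup F] [NormedSpace ℝ F]
    [SecondCountableTopology F] [MeasurableSpace F] [BorelSpace F] {A : Set T}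
    (hA : MeasurableSet A) {f : T → F} (hf : Measurable f) (h0 : ∫ t in A, f t ∂μ = 0) :
    ∫ z, A.indicator f (z (firstHit A z)) ∂Measure.infinitePi (fun _ : ℕ => μ) = 0 := by
  rw [← integral_map (f := A.indicator f) (measurable_apply_firstHit hA).aemeasurable
    (hf.indicator hA).aestronglyMeasurable, integral_indicator hA,
    map_apply_firstHit_restrict μ hA, integral_smul_measure, h0, smul_zero]

/-- The expected number of points in `S` before the first point in `A`. -/
theorem lintegral_card_before_firstHit_le {A S : Set T} (hA : MeasurableSet A)
    (hS : MeasurableSet S) [∀ z : ℕ → T, DecidablePred fun j => z j ∈ S] :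
    ∫⁻ z, ((Finset.range (firstHit A z)).filter fun j => z j ∈ S).card
      ∂Measure.infinitePi (fun _ : ℕ => μ) ≤ (μ A)⁻¹ * μ (S \ A) := by
  have hm : ∀ i, MeasurableSet {z : ℕ → T | (∀ k < i, z k ∉ A) ∧ z i ∈ S \ A} :=
    measurableSet_avoid_and_mem hA (hS.diff hA)
  -- Each counted index `i` has no point of `A` before it and its own point in `S \ A`; the
  -- probabilities of these events form a geometric series.
  calc _ ≤ ∫⁻ z, ∑' i, {z : ℕ → T | (∀ k < i, z k ∉ A) ∧ z i ∈ S \ A}.indicator 1 z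
      ∂Measure.infinitePi (fun _ : ℕ => μ) := by
        refine lintegral_mono fun z => ?_
        refine le_trans ?_ (ENNReal.sum_le_tsum
          ((Finset.range (firstHit A z)).filter fun j => z j ∈ S))
        rw [Finset.card_eq_sum_ones, Nat.cast_sum]
        refine Finset.sum_le_sum fun i hi => ?_
        rw [Finset.mem_filter, Finset.mem_range] at hi
        rw [Set.indicator_of_mem]
        · simp
        · exact ⟨fun k hk => notMem_of_lt_firstHit (hk.trans hi.1), hi.2,
            notMem_of_lt_firstHit hi.1⟩
    _ = ∑' i, (1 - μ A) ^ i * μ (S \ A) := by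
        rw [lintegral_tsum fun i => (measurable_one.indicator (hm i)).aemeasurable]
        congr 1
        funext i
        rw [lintegral_indicator_one (hm i), infinitePi_avoid_and_mem μ hA (hS.diff hA)]
    _ = _ := tsum_one_sub_pow_mul prob_le_one

end FirstHit

/-! ### Hashing the indices with shared random bits -/

/-- The first `l` bits of the hash of `i`. -/
def hashPrefix (h : ℕ → ℕ → Bool) (l i : ℕ) : List Bool := (List.range l).map fun k => h k i

@[simp] theorem length_hashPrefix (h : ℕ → ℕ → Bool) (l i : ℕ) :
    (hashPrefix h l i).length = l := by
  simp [hashPrefix]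

theorem hashPrefix_eq_iff {h : ℕ → ℕ → Bool} {l i j : ℕ} :
    hashPrefix h l i = hashPrefix h l j ↔ ∀ k < l, h k i = h k j := by
  simp [hashPrefix]

/-- The number of bits that distinguish the hash of `i` from the hashes of the elements of `S`. -/
noncomputable def hashLength (h : ℕ → ℕ → Bool) (S : Finset ℕ) (i : ℕ) : ℕ :=
  sInf {l | ∀ j ∈ S, hashPrefix h l j ≠ hashPrefix h l i}

/-- The distribution of independent uniform bits. -/
noncomputable def hashLaw : Measure (ℕ → ℕ → Bool) :=
  Measure.infinitePi fun _ => Measure.infinitePi fun _ => (PMF.uniformOfFintype Bool).toMeasure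

instance : IsProbabilityMeasure hashLaw := by
  unfold hashLaw
  infer_instance

theorem infinitePi_bool_eq {i j : ℕ} (hij : i ≠ j) :
    Measure.infinitePi (fun _ : ℕ => (PMF.uniformOfFintype Bool).toMeasure)
      {b | b i = b j} = 2⁻¹ := by
  have hc : ∀ c : Bool, Measure.infinitePi (fun _ : ℕ => (PMF.uniformOfFintype Bool).toMeasure)
      {b | b i = c ∧ b j = c} = 2⁻¹ * 2⁻¹ := by
    intro c
    have h : {b : ℕ → Bool | b i = c ∧ b j = c}
        = (({i, j} : Finset ℕ) : Set ℕ).pi fun _ => {c} := by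
      ext b
      simp
    rw [h, Measure.infinitePi_pi _ fun _ _ => measurableSet_singleton c, Finset.prod_pair hij,
      PMF.toMeasure_apply_singleton _ _ (measurableSet_singleton c)]
    simp
  have h : {b : ℕ → Bool | b i = b j}
      = {b | b i = true ∧ b j = true} ∪ {b | b i = false ∧ b j = false} := by
    ext b
    simp only [Set.mem_ofPred_eq, Set.mem_union]
    cases b i <;> cases b j <;> simp
  have hm : MeasurableSet {b : ℕ → Bool | b i = false ∧ b j = false} :=
    (Measurable.and
      (measurableSet_setOfPred.1 (measurableSet_eq_fun (measurable_pi_apply i) measurable_const))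
      (measurableSet_setOfPred.1
        (measurableSet_eq_fun (measurable_pi_apply j) measurable_const))).setOf
  rw [h, measure_union _ hm, hc, hc, ← two_mul, ← mul_assoc,
    ENNReal.mul_inv_cancel two_ne_zero ENNReal.ofNat_ne_top, one_mul]
  refine Set.disjoint_left.2 ?_
  rintro b ⟨h1, _⟩ ⟨h2, _⟩
  rw [h1] at h2
  exact absurd h2 (by decide)

/-- The outer coordinate of `h` is the bit position, so agreement of prefixes is a box of `l`
independent events of probability `1/2`. -/
theorem hashLaw_hashPrefix_eq {i j : ℕ} (hij : i ≠ j) (l : ℕ) :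
    hashLaw {h | hashPrefix h l i = hashPrefix h l j} = 2⁻¹ ^ l := by
  have hs : {h : ℕ → ℕ → Bool | hashPrefix h l i = hashPrefix h l j}
      = ((Finset.range l : Finset ℕ) : Set ℕ).pi fun _ => {b : ℕ → Bool | b i = b j} := by
    ext h
    simp [hashPrefix_eq_iff, Set.mem_pi]
  have hm : MeasurableSet {b : ℕ → Bool | b i = b j} :=
    measurableSet_eq_fun (measurable_pi_apply i) (measurable_pi_apply j)
  rw [hs, hashLaw, Measure.infinitePi_pi _ fun _ _ => hm]
  simp [infinitePi_bool_eq hij]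

theorem hashLaw_exists_collision_le {S : Finset ℕ} {i : ℕ} (hi : i ∉ S) (l : ℕ) :
    hashLaw {h | ∃ j ∈ S, hashPrefix h l j = hashPrefix h l i} ≤ S.card * 2⁻¹ ^ l := by
  have hs : {h : ℕ → ℕ → Bool | ∃ j ∈ S, hashPrefix h l j = hashPrefix h l i}
      = ⋃ j ∈ S, {h | hashPrefix h l j = hashPrefix h l i} := by
    ext h
    simp
  rw [hs]
  refine (measure_biUnion_finset_le S _).trans ?_
  rw [Finset.sum_congr rfl (g := fun _ => 2⁻¹ ^ l), Finset.sum_const, nsmul_eq_mul]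
  exact fun j hj => hashLaw_hashPrefix_eq (ne_of_mem_of_not_mem hj hi) l

/-- The defining infimum can be over the empty set, with value `0`. The union bound, letting the
length tend to infinity, shows that this has probability zero. -/
theorem ae_hashPrefix_hashLength_ne {S : Finset ℕ} {i : ℕ} (hi : i ∉ S) :
    ∀ᵐ h ∂hashLaw, ∀ j ∈ S,
      hashPrefix h (hashLength h S i) j ≠ hashPrefix h (hashLength h S i) i := by
  have h0 : hashLaw {h | ∀ l, ∃ j ∈ S, hashPrefix h l j = hashPrefix h l i} = 0 := by
    refine le_antisymm (ge_of_tendsto' (x := Filter.atTop)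
      (f := fun l : ℕ => (S.card : ENNReal) * 2⁻¹ ^ l) ?_
      fun l => (measure_mono (Set.ofPred_subset_ofPred.2 fun h hh => hh l)).trans
        (hashLaw_exists_collision_le hi l)) bot_le
    have := ENNReal.Tendsto.const_mul (a := (S.card : ENNReal))
      (ENNReal.tendsto_pow_atTop_nhds_zero_of_lt_one (r := 2⁻¹) (by simp))
      (Or.inr (ENNReal.natCast_ne_top _))
    simpa using this
  filter_upwards [compl_mem_ae_iff.2 h0] with h hh
  simp only [Set.mem_compl_iff, Set.mem_ofPred_eq, not_forall] at hh
  obtain ⟨l, hl⟩ := hh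
  push Not at hl
  exact (Nat.sInf_mem (s := {l | ∀ j ∈ S, hashPrefix h l j ≠ hashPrefix h l i}) ⟨l, hl⟩)

theorem lintegral_hashLength_le {S : Finset ℕ} {i : ℕ} (hi : i ∉ S) :
    ∫⁻ h, (hashLength h S i : ENNReal) ∂hashLaw
      ≤ ENNReal.ofReal (4 * Real.logb 2 (1 + S.card)) := by
  have hcol : ∀ {h : ℕ → ℕ → Bool} {l : ℕ}, l < hashLength h S i →
      ∃ j ∈ S, hashPrefix h l j = hashPrefix h l i := by
    intro h l hl
    have := Nat.notMem_of_lt_sInf hl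
    simpa using this
  -- Without rivals no bit is sent. This removes any additive constant from the cost and makes it
  -- sublinear in `d` for small `q`.
  rcases S.eq_empty_or_nonempty with rfl | hS
  · have : ∀ h, hashLength h ∅ i = 0 := by
      intro h
      by_contra hne
      obtain ⟨j, hj, _⟩ := hcol (Nat.pos_of_ne_zero hne)
      simp at hj
    simp [this]
  have hpre : ∀ l j : ℕ, Measurable fun h : ℕ → ℕ → Bool => ∀ k < l, h k j = h k i := by
    intro l j
    refine .forall fun k => .imp measurable_const (measurableSet_setOfPred.1 ?_)
    exact measurableSet_eq_fun ((measurable_pi_apply j).comp (measurable_pi_apply k))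
      ((measurable_pi_apply i).comp (measurable_pi_apply k))
  have hm : ∀ l, MeasurableSet {h : ℕ → ℕ → Bool | ∃ j ∈ S,
      hashPrefix h l j = hashPrefix h l i} := by
    intro l
    simp only [hashPrefix_eq_iff]
    exact (Measurable.exists fun j => .and measurable_const (hpre l j)).setOf
  have hM : 1 ≤ S.card := hS.card_pos
  set M := S.card
  -- The tail sum for the expectation is cut at `k`: the first `k` terms are at most `1`, and since
  -- `M ≤ 2 ^ k` the others sum to at most `2`. The total `log₂ M + 3` is at most `4 log₂(1 + M)`
  -- because `M ≥ 1`.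
  set k := Nat.log 2 M + 1
  have hk : M ≤ 2 ^ k := (Nat.lt_pow_succ_log_self one_lt_two M).le
  calc ∫⁻ h, (hashLength h S i : ENNReal) ∂hashLaw
      ≤ ∫⁻ h, ∑' l, {h : ℕ → ℕ → Bool | ∃ j ∈ S,
          hashPrefix h l j = hashPrefix h l i}.indicator 1 h ∂hashLaw := by
        refine lintegral_mono fun h => ?_
        refine le_trans ?_ (ENNReal.sum_le_tsum (Finset.range (hashLength h S i)))
        rw [Finset.sum_congr rfl (g := fun _ => (1 : ENNReal))]
        · simp
        · intro l hl
          rw [Set.indicator_of_mem (Set.mem_ofPred_eq ▸ hcol (Finset.mem_range.1 hl))]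
          rfl
    _ = ∑' l, hashLaw {h | ∃ j ∈ S, hashPrefix h l j = hashPrefix h l i} := by
        rw [lintegral_tsum fun l => (measurable_one.indicator (hm l)).aemeasurable]
        exact tsum_congr fun l => lintegral_indicator_one (hm l)
    _ = ∑ l ∈ Finset.range k, hashLaw {h | ∃ j ∈ S, hashPrefix h l j = hashPrefix h l i}
        + ∑' l, hashLaw {h | ∃ j ∈ S, hashPrefix h (l + k) j = hashPrefix h (l + k) i} :=
        (Summable.sum_add_tsum_nat_add' ENNReal.summable).symm
    _ ≤ ∑ l ∈ Finset.range k, 1 + ∑' l : ℕ, 2⁻¹ ^ l := by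
        refine add_le_add (Finset.sum_le_sum fun _ _ => prob_le_one)
          (ENNReal.tsum_le_tsum fun l => (hashLaw_exists_collision_le hi _).trans ?_)
        rw [pow_add, mul_left_comm]
        refine mul_le_of_le_one_right bot_le ?_
        have h2 : (M : ENNReal) ≤ 2 ^ k := by exact_mod_cast hk
        calc (M : ENNReal) * 2⁻¹ ^ k ≤ 2 ^ k * 2⁻¹ ^ k := by gcongr
          _ = 1 := by
            rw [← mul_pow, ENNReal.mul_inv_cancel two_ne_zero ENNReal.ofNat_ne_top, one_pow]
    _ = ENNReal.ofReal (k + 2) := by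
        rw [ENNReal.tsum_geometric, ENNReal.one_sub_inv_two, inv_inv,
          ENNReal.ofReal_add (by positivity) (by positivity)]
        simp
    _ ≤ _ := by
        refine ENNReal.ofReal_le_ofReal ?_
        have hMr : (1 : ℝ) ≤ M := by exact_mod_cast hM
        have h1 : (Nat.log 2 M : ℝ) ≤ Real.logb 2 M := by
          exact_mod_cast Real.natLog_le_logb M 2
        have h2 : Real.logb 2 M ≤ Real.logb 2 (1 + M) :=
          Real.logb_le_logb_of_le one_lt_two (by linarith) (by linarith)
        have h3 : 1 ≤ Real.logb 2 (1 + M) := by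
          rw [Real.le_logb_iff_rpow_le one_lt_two (by linarith)]
          norm_num
          linarith
        have h4 : (k : ℝ) = Nat.log 2 M + 1 := by simp [k]
        linarith

/-- An expectation version of the concavity of the logarithm. -/
theorem lintegral_logb_one_add_le {α : Type*} [MeasurableSpace α] (μ : Measure α)
    [IsProbabilityMeasure μ] (N : α → ℕ) {m : ℝ} (hm : 0 ≤ m)
    (hN : ∫⁻ a, (N a : ENNReal) ∂μ ≤ ENNReal.ofReal m) :
    ∫⁻ a, ENNReal.ofReal (Real.logb 2 (1 + N a)) ∂μ ≤ ENNReal.ofReal (Real.logb 2 (1 + m)) := by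
  have hl2 : 0 < Real.log 2 := Real.log_pos one_lt_two
  set c : ℝ := (Real.log 2 * (1 + m))⁻¹ with hc
  have hc0 : 0 ≤ c := by positivity
  have hlog : 0 ≤ Real.logb 2 (1 + m) := Real.logb_nonneg one_lt_two (by linarith)
  -- The tangent line at `m`, of slope `c`, lies above the logarithm. The term `c * m` stays on the
  -- left to avoid truncated subtraction in `ENNReal`.
  have hpt : ∀ a, Real.logb 2 (1 + N a) + c * m ≤ Real.logb 2 (1 + m) + c * N a := by
    intro a
    have hNa : (0 : ℝ) ≤ N a := Nat.cast_nonneg _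
    have h1 := Real.log_le_sub_one_of_pos (x := (1 + N a) / (1 + m)) (by positivity)
    rw [Real.log_div (by positivity) (by positivity)] at h1
    have h2 : (1 + N a) / (1 + m) - 1 = (N a - m) / (1 + m) := by field_simp; ring
    rw [h2] at h1
    have h3 : (Real.log (1 + N a) - Real.log (1 + m)) / Real.log 2
        ≤ (N a - m) / (1 + m) / Real.log 2 := by gcongr
    have h4 : (N a - m) / (1 + m) / Real.log 2 = c * N a - c * m := by
      rw [hc]; field_simp
    rw [sub_div, h4] at h3
    simp only [Real.logb]
    linarith
  have hle : ∫⁻ a, ENNReal.ofReal (Real.logb 2 (1 + N a)) ∂μ + ENNReal.ofReal (c * m)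
      ≤ ENNReal.ofReal (Real.logb 2 (1 + m)) + ENNReal.ofReal (c * m) := by
    calc _ = ∫⁻ a, (ENNReal.ofReal (Real.logb 2 (1 + N a)) + ENNReal.ofReal (c * m)) ∂μ := by
          rw [lintegral_add_right _ measurable_const]; simp
      _ ≤ ∫⁻ a, (ENNReal.ofReal (Real.logb 2 (1 + m)) + ENNReal.ofReal c * N a) ∂μ := by
          refine lintegral_mono fun a => ?_
          have hNa : (0 : ℝ) ≤ N a := Nat.cast_nonneg _
          have h5 : ENNReal.ofReal c * N a = ENNReal.ofReal (c * N a) := by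
            rw [ENNReal.ofReal_mul hc0, ENNReal.ofReal_natCast]
          rw [h5, ← ENNReal.ofReal_add hlog (by positivity),
            ← ENNReal.ofReal_add (Real.logb_nonneg one_lt_two (by linarith)) (by positivity)]
          exact ENNReal.ofReal_le_ofReal (hpt a)
      _ = ENNReal.ofReal (Real.logb 2 (1 + m))
          + ENNReal.ofReal c * ∫⁻ a, (N a : ENNReal) ∂μ := by
          rw [lintegral_add_left measurable_const, lintegral_const_mul' _ _ ENNReal.ofReal_ne_top]
          simp
      _ ≤ _ := by
          rw [ENNReal.ofReal_mul hc0]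
          gcongr
  exact (ENNReal.add_le_add_iff_right ENNReal.ofReal_ne_top).1 hle

/-! ### Quantization with shared randomness -/

instance List.measurableSpaceBool : MeasurableSpace (List Bool) := ⊤

instance List.discreteMeasurableSpaceBool : DiscreteMeasurableSpace (List Bool) := ⟨fun _ => trivial⟩

/-- A randomized quantizer of `ℝ^d` with error at most `r`, whose quantization of `x` can be encoded
in at most `b` expected bits for receivers that know `x` up to distance `δ`. -/
structure Quantizer (d : ℕ) (r δ b : ℝ) where
  /-- The space of shared random strings. -/
  Θ : Type
  [measurableSpace : MeasurableSpace Θ]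
  /-- The distribution of the shared random string. -/
  law : Measure Θ
  [isProbabilityMeasure : IsProbabilityMeasure law]
  /-- The quantization of a point. -/
  quant : Θ → EuclideanSpace ℝ (Fin d) → EuclideanSpace ℝ (Fin d)
  /-- The encoding of the quantization of a point. -/
  enc : Θ → EuclideanSpace ℝ (Fin d) → List Bool
  /-- The decoding of a string by a machine that knows an approximation of the point. -/
  dec : Θ → EuclideanSpace ℝ (Fin d) → List Bool → EuclideanSpace ℝ (Fin d)
  measurable_quant : Measurable fun p : Θ × EuclideanSpace ℝ (Fin d) => quant p.1 p.2
  measurable_enc : Measurable fun p : Θ × EuclideanSpace ℝ (Fin d) => enc p.1 p.2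
  measurable_dec : ∀ x m, Measurable fun θ => dec θ x m
  norm_quant_sub_le : ∀ θ x, ‖quant θ x - x‖ ≤ r
  integral_quant : ∀ x, ∫ θ, quant θ x ∂law = x
  ae_dec_enc : ∀ x, ∀ᵐ θ ∂law, ∀ x', ‖x - x'‖ ≤ δ → dec θ x' (enc θ x) = quant θ x
  lintegral_length_enc_le : ∀ x, ∫⁻ θ, ((enc θ x).length : ENNReal) ∂law ≤ ENNReal.ofReal b

attribute [instance] Quantizer.measurableSpace Quantizer.isProbabilityMeasure

section BallQuantizer

variable {d : ℕ}

/-- The shared randomness: a sequence of points of the torus, and hashes of the indices. -/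
abbrev BallSeed (d : ℕ) : Type := (ℕ → Fin d → UnitAddCircle) × (ℕ → ℕ → Bool)

/-- The distribution of the shared randomness. -/
noncomputable def ballSeedLaw (d : ℕ) : Measure (BallSeed d) :=
  (Measure.infinitePi fun _ => volume).prod hashLaw

instance : IsProbabilityMeasure (volume : Measure UnitAddCircle) := ⟨by simp⟩

instance : IsProbabilityMeasure (ballSeedLaw d) := by
  unfold ballSeedLaw
  infer_instance

theorem Measurable.displacement {α : Type*} [MeasurableSpace α] (L : ℝ)
    {f : α → Fin d → UnitAddCircle} {g : α → EuclideanSpace ℝ (Fin d)} (hf : Measurable f)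
    (hg : Measurable g) : Measurable fun a => displacement L (f a) (g a) :=
  (measurable_displacement L).comp (hf.prodMk hg)

theorem measurable_seed_apply (k : ℕ) : Measurable fun θ : BallSeed d => θ.1 k :=
  (measurable_pi_apply k).comp measurable_fst

/-- The points of the torus with a representative at distance at most `ρ` from `x`. -/
def nearPoints (L ρ : ℝ) (x : EuclideanSpace ℝ (Fin d)) : Set (Fin d → UnitAddCircle) :=
  {t | ‖displacement L t x‖ ≤ ρ}

theorem mem_nearPoints {L ρ : ℝ} {x : EuclideanSpace ℝ (Fin d)} {t : Fin d → UnitAddCircle} :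
    t ∈ nearPoints L ρ x ↔ ‖displacement L t x‖ ≤ ρ := Iff.rfl

theorem measurableSet_nearPoints (L ρ : ℝ) (x : EuclideanSpace ℝ (Fin d)) :
    MeasurableSet (nearPoints L ρ x) :=
  (Measurable.displacement L measurable_id measurable_const).norm measurableSet_Iic

attribute [irreducible] nearPoints

/-- The index of the first point of the sequence within distance `r` of `x`. -/
noncomputable def ballIndex (L r : ℝ) (θ : BallSeed d) (x : EuclideanSpace ℝ (Fin d)) : ℕ :=
  firstHit (nearPoints L r x) θ.1

/-- The first point of the sequence within distance `r` of `x`. -/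
noncomputable def ballQuant (L r : ℝ) (θ : BallSeed d) (x : EuclideanSpace ℝ (Fin d)) :
    EuclideanSpace ℝ (Fin d) :=
  x + (nearPoints L r x).indicator (displacement L · x) (θ.1 (ballIndex L r θ x))

open Classical in
/-- The earlier indices with which the index of the quantization of `x` could be confused. -/
noncomputable def ballRivals (L r δ : ℝ) (z : ℕ → Fin d → UnitAddCircle)
    (x : EuclideanSpace ℝ (Fin d)) : Finset ℕ :=
  (Finset.range (firstHit (nearPoints L r x) z)).filter fun j => z j ∈ nearPoints L (r + 2 * δ) x

/-- The number of bits that exclude all rivals of the index of the quantization of `x`. -/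
noncomputable def ballLength (L r δ : ℝ) (θ : BallSeed d) (x : EuclideanSpace ℝ (Fin d)) : ℕ :=
  hashLength θ.2 (ballRivals L r δ θ.1 x) (ballIndex L r θ x)

/-- The hash of the index of the quantization of `x`, long enough to exclude all rivals. -/
noncomputable def ballEnc (L r δ : ℝ) (θ : BallSeed d) (x : EuclideanSpace ℝ (Fin d)) :
    List Bool :=
  hashPrefix θ.2 (ballLength L r δ θ x) (ballIndex L r θ x)

/-- The first index with hash `m` whose point is within distance `ρ` of `x`. -/
noncomputable def ballDecIndex (L ρ : ℝ) (θ : BallSeed d) (x : EuclideanSpace ℝ (Fin d))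
    (m : List Bool) : ℕ :=
  sInf {k | θ.1 k ∈ nearPoints L ρ x ∧ hashPrefix θ.2 m.length k = m}

/-- The first point with hash `m` within distance `ρ` of `x`. -/
noncomputable def ballDec (L ρ : ℝ) (θ : BallSeed d) (x : EuclideanSpace ℝ (Fin d))
    (m : List Bool) : EuclideanSpace ℝ (Fin d) :=
  x + displacement L (θ.1 (ballDecIndex L ρ θ x m)) x

theorem nearPoints_subset_nearPoints {L ρ δ : ℝ} (hL : 0 < L) (hρ : ρ + δ < L / 2)
    {x x' : EuclideanSpace ℝ (Fin d)} (h : ‖x - x'‖ ≤ δ) {t : Fin d → UnitAddCircle}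
    (ht : t ∈ nearPoints L ρ x) :
    displacement L t x' = displacement L t x + (x - x') ∧ t ∈ nearPoints L (ρ + δ) x' := by
  have h1 : ‖displacement L t x + (x - x')‖ ≤ ρ + δ :=
    (norm_add_le _ _).trans (add_le_add (mem_nearPoints.1 ht) h)
  have h2 := displacement_eq_add hL (h1.trans_lt hρ)
  exact ⟨h2, by rw [mem_nearPoints, h2]; exact h1⟩

/-- The true index passes the receiver's test, since its point is within `r + δ` of `x'`. An earlier
index passing the test would have its point within `r + 2δ` of `x`, hence be a rival, and rivals
have a different hash prefix. -/
theorem ballDec_ballEnc {L r δ : ℝ} (hL : 0 < L) (hδ : 0 ≤ δ) (hLr : r + 2 * δ < L / 2)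
    {θ : BallSeed d} {x : EuclideanSpace ℝ (Fin d)} (hx : ∃ k, θ.1 k ∈ nearPoints L r x)
    (hh : ∀ j ∈ ballRivals L r δ θ.1 x,
      hashPrefix θ.2 (ballLength L r δ θ x) j ≠ ballEnc L r δ θ x)
    {x' : EuclideanSpace ℝ (Fin d)} (hxx' : ‖x - x'‖ ≤ δ) :
    ballDec L (r + δ) θ x' (ballEnc L r δ θ x) = ballQuant L r θ x := by
  have hi : θ.1 (ballIndex L r θ x) ∈ nearPoints L r x := firstHit_mem hx
  obtain ⟨h1, h2⟩ := nearPoints_subset_nearPoints hL (by linarith) hxx' hi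
  have hidx : ballDecIndex L (r + δ) θ x' (ballEnc L r δ θ x) = ballIndex L r θ x := by
    have hmem : ballIndex L r θ x ∈ {k | θ.1 k ∈ nearPoints L (r + δ) x' ∧
        hashPrefix θ.2 (ballEnc L r δ θ x).length k = ballEnc L r δ θ x} :=
      ⟨h2, by simp [ballEnc]⟩
    refine le_antisymm (Nat.sInf_le hmem) (le_csInf ⟨_, hmem⟩ ?_)
    rintro j ⟨hj1, hj2⟩
    by_contra hlt
    obtain ⟨_, h3⟩ := nearPoints_subset_nearPoints (δ := δ) hL (by linarith)
      (by rwa [norm_sub_rev]) hj1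
    refine hh j ?_ ?_
    · simp only [ballRivals, Finset.mem_filter, Finset.mem_range]
      refine ⟨not_le.1 hlt, ?_⟩
      rw [two_mul, ← add_assoc]
      exact h3
    · simpa [ballEnc] using hj2
  rw [ballDec, hidx, h1, ballQuant, Set.indicator_of_mem hi]
  abel

/-! ### Measurability of the quantizer -/

theorem Measurable.mem_nearPoints {α : Type*} [MeasurableSpace α] (L ρ : ℝ)
    {f : α → Fin d → UnitAddCircle} {g : α → EuclideanSpace ℝ (Fin d)} (hf : Measurable f)
    (hg : Measurable g) : Measurable fun a => f a ∈ nearPoints L ρ (g a) := by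
  simp only [_root_.mem_nearPoints]
  exact measurableSet_setOfPred.1
    (measurableSet_le (Measurable.displacement L hf hg).norm measurable_const)

theorem measurable_mem_nearPoints (L ρ : ℝ) (k : ℕ) :
    Measurable fun p : BallSeed d × EuclideanSpace ℝ (Fin d) =>
      p.1.1 k ∈ nearPoints L ρ p.2 :=
  Measurable.mem_nearPoints L ρ ((measurable_seed_apply k).comp measurable_fst) measurable_snd

theorem notMem_ballRivals (L r δ : ℝ) (z : ℕ → Fin d → UnitAddCircle)
    (x : EuclideanSpace ℝ (Fin d)) :
    firstHit (nearPoints L r x) z ∉ ballRivals L r δ z x := by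
  classical
  exact fun h => absurd (Finset.mem_range.1 (Finset.mem_filter.1 h).1) (lt_irrefl _)

theorem measurable_ballIndex (L r : ℝ) :
    Measurable fun p : BallSeed d × EuclideanSpace ℝ (Fin d) => ballIndex L r p.1 p.2 :=
  measurable_sInf_nat fun k => measurable_mem_nearPoints L r k

/-- Joint measurability in seed and point is needed because the leader quantizes a random aggregate.
-/
theorem measurable_ballQuant (L r : ℝ) :
    Measurable fun p : BallSeed d × EuclideanSpace ℝ (Fin d) => ballQuant L r p.1 p.2 := by
  classical
  refine measurable_snd.add (measurable_of_countable_index (measurable_ballIndex L r)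
    (f := fun k (p : BallSeed d × EuclideanSpace ℝ (Fin d)) =>
      (nearPoints L r p.2).indicator (displacement L · p.2) (p.1.1 k)) fun k => ?_)
  simp only [Set.indicator_apply]
  exact Measurable.ite (measurable_mem_nearPoints L r k).setOf
    (Measurable.displacement L ((measurable_seed_apply k).comp measurable_fst) measurable_snd)
    measurable_const

theorem measurable_hashPrefix (l i : ℕ) : Measurable fun h => hashPrefix h l i := by
  induction l with
  | zero => exact measurable_const
  | succ l ih =>
    have h1 : ∀ h, hashPrefix h (l + 1) i = hashPrefix h l i ++ [h l i] := by
      intro h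
      simp [hashPrefix, List.range_succ]
    simp only [h1]
    exact (Measurable.of_discrete (f := fun p : List Bool × Bool => p.1 ++ [p.2])).comp
      (ih.prodMk ((measurable_pi_apply i).comp (measurable_pi_apply l)))

theorem measurable_ballLength (L r δ : ℝ) :
    Measurable fun p : BallSeed d × EuclideanSpace ℝ (Fin d) => ballLength L r δ p.1 p.2 := by
  refine measurable_sInf_nat fun l => ?_
  have h : ∀ j, Measurable fun p : BallSeed d × EuclideanSpace ℝ (Fin d) =>
      hashPrefix p.1.2 l j :=
    fun j => (measurable_hashPrefix l j).comp (measurable_snd.comp measurable_fst)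
  have := measurable_of_countable_index (measurable_ballIndex L r)
    (f := fun k (p : BallSeed d × EuclideanSpace ℝ (Fin d)) =>
      ∀ j, j < k ∧ p.1.1 j ∈ nearPoints L (r + 2 * δ) p.2 →
        ¬ hashPrefix p.1.2 l j = hashPrefix p.1.2 l k) fun k =>
      .forall fun j => .imp (.and measurable_const (measurable_mem_nearPoints L _ j))
        (.not (measurableSet_setOfPred.1 (measurableSet_eq_fun (h j) (h k))))
  simpa only [ballRivals, ballIndex, Finset.mem_filter, Finset.mem_range, ne_eq] using this

attribute [irreducible] ballLength

theorem measurable_ballEnc (L r δ : ℝ) :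
    Measurable fun p : BallSeed d × EuclideanSpace ℝ (Fin d) => ballEnc L r δ p.1 p.2 :=
  measurable_of_countable_index
    ((measurable_ballLength L r δ).prodMk (measurable_ballIndex L r))
    (f := fun k (p : BallSeed d × EuclideanSpace ℝ (Fin d)) => hashPrefix p.1.2 k.1 k.2)
    fun k => (measurable_hashPrefix k.1 k.2).comp (measurable_snd.comp measurable_fst)

theorem measurable_ballDec (L ρ : ℝ) (x : EuclideanSpace ℝ (Fin d)) (m : List Bool) :
    Measurable fun θ : BallSeed d => ballDec L ρ θ x m := by
  have hi : Measurable fun θ : BallSeed d => ballDecIndex L ρ θ x m := by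
    refine measurable_sInf_nat fun k => .and ?_ (measurableSet_setOfPred.1 ?_)
    · exact Measurable.mem_nearPoints L ρ (measurable_seed_apply k) measurable_const
    · exact measurableSet_eq_fun ((measurable_hashPrefix _ k).comp measurable_snd)
        measurable_const
  exact measurable_const.add (measurable_of_countable_index hi
    (f := fun k (θ : BallSeed d) => displacement L (θ.1 k) x) fun k =>
    Measurable.displacement L (measurable_seed_apply k) measurable_const)

/-! ### Error, unbiasedness, decoding and cost of the quantizer -/

theorem norm_ballQuant_sub_le {L r : ℝ} (hr : 0 ≤ r) (θ : BallSeed d)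
    (x : EuclideanSpace ℝ (Fin d)) : ‖ballQuant L r θ x - x‖ ≤ r := by
  -- The indicator in `ballQuant` gives the bound for every seed, including those that never hit.
  rw [ballQuant, add_sub_cancel_left]
  by_cases h : θ.1 (ballIndex L r θ x) ∈ nearPoints L r x
  · rw [Set.indicator_of_mem h]
    exact mem_nearPoints.1 h
  · rw [Set.indicator_of_notMem h, norm_zero]
    exact hr

theorem integral_ballQuant {L r : ℝ} (hL : 0 < L) (hr : 0 ≤ r) (hLr : r < L / 2)
    (x : EuclideanSpace ℝ (Fin d)) : ∫ θ, ballQuant L r θ x ∂ballSeedLaw d = x := by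
  have hA := measurableSet_nearPoints L r x
  have hdisp : Measurable fun t => displacement L t x :=
    Measurable.displacement L measurable_id measurable_const
  have hm : Measurable fun θ : BallSeed d => ballQuant L r θ x :=
    (measurable_ballQuant L r).comp measurable_prodMk_right
  have h0 : ∫ θ, (ballQuant L r θ x - x) ∂ballSeedLaw d = 0 := by
    have h1 := integral_indicator_apply_firstHit volume hA hdisp
      (by rw [nearPoints]; exact integral_displacement_eq_zero hL hLr x)
    rw [← (measurePreserving_fst (μ := Measure.infinitePi fun _ : ℕ =>
      (volume : Measure (Fin d → UnitAddCircle))) (ν := hashLaw)).map_eq,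
      integral_map measurable_fst.aemeasurable] at h1
    · rw [← h1]
      refine integral_congr_ae (Filter.Eventually.of_forall fun θ => ?_)
      simp [ballQuant, ballIndex]
    · exact ((hdisp.indicator hA).comp (measurable_apply_firstHit hA)).aestronglyMeasurable
  have hint : Integrable (fun θ => ballQuant L r θ x - x) (ballSeedLaw d) :=
    Integrable.of_bound (hm.sub_const x).aestronglyMeasurable r
      (Filter.Eventually.of_forall fun θ => norm_ballQuant_sub_le hr θ x)
  have h2 : ∫ θ, ((ballQuant L r θ x - x) + x) ∂ballSeedLaw d = x := by
    rw [integral_add hint (integrable_const x), h0]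
    simp
  simpa using h2

theorem volume_nearPoints_ne_zero {L r : ℝ} (hL : 0 < L) (hr : 0 < r) (hLr : r < L / 2)
    (x : EuclideanSpace ℝ (Fin d)) : volume (nearPoints L r x) ≠ 0 := by
  rw [nearPoints, volume_norm_displacement_le hL hr.le hLr]
  refine mul_ne_zero ?_ (Metric.measure_ball_pos volume _ one_pos).ne'
  rw [ne_eq, ENNReal.ofReal_eq_zero, not_le]
  positivity

theorem measurableSet_no_collision (L r δ : ℝ) (x : EuclideanSpace ℝ (Fin d)) :
    MeasurableSet {θ : BallSeed d | ∀ j ∈ ballRivals L r δ θ.1 x,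
      hashPrefix θ.2 (ballLength L r δ θ x) j ≠ ballEnc L r δ θ x} := by
  have hx : Measurable fun θ : BallSeed d => (θ, x) := measurable_prodMk_right
  have hi : Measurable fun θ : BallSeed d => ballIndex L r θ x :=
    (measurable_ballIndex L r).comp hx
  have hl : Measurable fun θ : BallSeed d => ballLength L r δ θ x :=
    (measurable_ballLength L r δ).comp hx
  have he : Measurable fun θ : BallSeed d => ballEnc L r δ θ x :=
    (measurable_ballEnc L r δ).comp hx
  have hp : ∀ l j, Measurable fun θ : BallSeed d => hashPrefix θ.2 l j :=
    fun l j => (measurable_hashPrefix l j).comp measurable_snd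
  have heq : ∀ l j, Measurable fun θ : BallSeed d => hashPrefix θ.2 l j = ballEnc L r δ θ x :=
    fun l j => measurableSet_setOfPred.1 (measurableSet_eq_fun (hp l j) he)
  have hk : ∀ k : ℕ × ℕ, Measurable fun θ : BallSeed d =>
      ∀ j, j < k.2 ∧ θ.1 j ∈ nearPoints L (r + 2 * δ) x →
        ¬ hashPrefix θ.2 k.1 j = ballEnc L r δ θ x :=
    fun k => .forall fun j => .imp (.and measurable_const
      (Measurable.mem_nearPoints L _ (measurable_seed_apply j) measurable_const))
      (.not (heq k.1 j))
  have := (measurable_of_countable_index (hl.prodMk hi) hk).setOf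
  simp only [ballIndex] at this
  simpa only [ballRivals, ballIndex, Finset.mem_filter, Finset.mem_range, ne_eq] using this

theorem ae_ballDec_ballEnc {L r δ : ℝ} (hL : 0 < L) (hr : 0 < r) (hδ : 0 ≤ δ)
    (hLr : r + 2 * δ < L / 2) (x : EuclideanSpace ℝ (Fin d)) :
    ∀ᵐ θ ∂ballSeedLaw d, ∀ x', ‖x - x'‖ ≤ δ →
      ballDec L (r + δ) θ x' (ballEnc L r δ θ x) = ballQuant L r θ x := by
  have h1 : ∀ᵐ θ ∂ballSeedLaw d, ∃ k, θ.1 k ∈ nearPoints L r x :=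
    Measure.quasiMeasurePreserving_fst.ae (ae_exists_mem volume (measurableSet_nearPoints L r x)
      (volume_nearPoints_ne_zero hL hr (by linarith) x))
  have h2 : ∀ᵐ θ ∂ballSeedLaw d, ∀ j ∈ ballRivals L r δ θ.1 x,
      hashPrefix θ.2 (ballLength L r δ θ x) j ≠ ballEnc L r δ θ x := by
    -- For a fixed sequence `z` the rivals form a fixed finite set, independent of the hash.
    refine (Measure.ae_prod_iff_ae_ae (measurableSet_no_collision L r δ x)).2
      (Filter.Eventually.of_forall fun z => ?_)
    simp only [ballEnc, ballLength, ballIndex]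
    exact ae_hashPrefix_hashLength_ne (notMem_ballRivals L r δ z x)
  filter_upwards [h1, h2] with θ hθ1 hθ2 x' hx'
  exact ballDec_ballEnc hL hδ hLr hθ1 hθ2 hx'

/-- The bound is the volume of the shell between radii `r` and `r + 2δ` divided by that of the ball
of radius `r`. -/
theorem lintegral_card_ballRivals_le {L r δ : ℝ} (hL : 0 < L) (hr : 0 < r) (hδ : 0 ≤ δ)
    (hLr : r + 2 * δ < L / 2) (x : EuclideanSpace ℝ (Fin d)) :
    ∫⁻ z, ((ballRivals L r δ z x).card : ENNReal)
        ∂Measure.infinitePi (fun _ : ℕ => (volume : Measure (Fin d → UnitAddCircle)))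
      ≤ ENNReal.ofReal ((1 + 2 * δ / r) ^ d - 1) := by
  classical
  have hA := measurableSet_nearPoints L r x
  have h0 := volume_nearPoints_ne_zero hL hr (by linarith) x
  have hsub : nearPoints L r x ⊆ nearPoints L (r + 2 * δ) x := fun t ht =>
    mem_nearPoints.2 ((mem_nearPoints.1 ht).trans (by linarith))
  have hvol : volume (nearPoints L (r + 2 * δ) x)
      = ENNReal.ofReal ((1 + 2 * δ / r) ^ d) * volume (nearPoints L r x) := by
    rw [nearPoints, nearPoints, volume_norm_displacement_le hL (by positivity) hLr,
      volume_norm_displacement_le hL hr.le (by linarith), ← mul_assoc,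
      ← ENNReal.ofReal_mul (by positivity), ← mul_pow]
    congr 4
    field_simp
  have hone : (1 : ℝ) ≤ (1 + 2 * δ / r) ^ d := one_le_pow₀ (by
    have : 0 ≤ 2 * δ / r := by positivity
    linarith)
  calc _ ≤ (volume (nearPoints L r x))⁻¹
        * volume (nearPoints L (r + 2 * δ) x \ nearPoints L r x) :=
        lintegral_card_before_firstHit_le volume hA (measurableSet_nearPoints L (r + 2 * δ) x)
    _ = (volume (nearPoints L r x))⁻¹
        * (ENNReal.ofReal ((1 + 2 * δ / r) ^ d - 1) * volume (nearPoints L r x)) := by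
        rw [measure_sdiff hsub hA.nullMeasurableSet (measure_ne_top _ _), hvol,
          ENNReal.ofReal_sub _ zero_le_one, ENNReal.sub_mul fun _ _ => measure_ne_top _ _,
          ENNReal.ofReal_one, one_mul]
    _ = ENNReal.ofReal ((1 + 2 * δ / r) ^ d - 1) := by
        rw [mul_left_comm, ENNReal.inv_mul_cancel h0 (measure_ne_top _ _), mul_one]

theorem lintegral_length_ballEnc_le {L r δ : ℝ} (hL : 0 < L) (hr : 0 < r) (hδ : 0 ≤ δ)
    (hLr : r + 2 * δ < L / 2) (x : EuclideanSpace ℝ (Fin d)) :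
    ∫⁻ θ, ((ballEnc L r δ θ x).length : ENNReal) ∂ballSeedLaw d
      ≤ ENNReal.ofReal (4 * (d * Real.logb 2 (1 + 2 * δ / r))) := by
  have hm : Measurable fun θ : BallSeed d => ((ballEnc L r δ θ x).length : ENNReal) :=
    (Measurable.of_discrete (f := fun m : List Bool => (m.length : ENNReal))).comp
      ((measurable_ballEnc L r δ).comp measurable_prodMk_right)
  have h4 : ∀ t : ℝ, ENNReal.ofReal (4 * t) = 4 * ENNReal.ofReal t := fun t => by
    rw [ENNReal.ofReal_mul (by norm_num), ENNReal.ofReal_ofNat]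
  have hq : 0 ≤ 2 * δ / r := by positivity
  have hone : (1 : ℝ) ≤ (1 + 2 * δ / r) ^ d := one_le_pow₀ (by linarith)
  rw [ballSeedLaw] at *
  rw [lintegral_prod _ hm.aemeasurable]
  calc _ ≤ ∫⁻ z, ENNReal.ofReal (4 * Real.logb 2 (1 + (ballRivals L r δ z x).card))
        ∂Measure.infinitePi (fun _ : ℕ => (volume : Measure (Fin d → UnitAddCircle))) := by
        refine lintegral_mono fun z => ?_
        simp only [ballEnc, length_hashPrefix, ballLength, ballIndex]
        exact lintegral_hashLength_le (notMem_ballRivals L r δ z x)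
    _ ≤ 4 * ENNReal.ofReal (Real.logb 2 (1 + ((1 + 2 * δ / r) ^ d - 1))) := by
        simp only [h4]
        rw [lintegral_const_mul' _ _ ENNReal.ofNat_ne_top]
        gcongr
        exact lintegral_logb_one_add_le _ _ (by linarith)
          (lintegral_card_ballRivals_le hL hr hδ hLr x)
    _ = _ := by
        rw [h4, add_sub_cancel, Real.logb_pow]

/-- The quantizer that moves every point to the first element of a shared random sequence of
points of the torus which lies within distance `r` of it. -/
noncomputable def ballQuantizer (d : ℕ) {r δ : ℝ} (hr : 0 < r) (hδ : 0 ≤ δ) :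
    Quantizer d r δ (4 * (d * Real.logb 2 (1 + 2 * δ / r))) :=
  -- Any side length above `2 * (r + 2 * δ)` would do; the cost does not depend on it.
  have hL : 0 < 4 * (r + 2 * δ) := by positivity
  have hLr : r + 2 * δ < 4 * (r + 2 * δ) / 2 := by linarith
  { Θ := BallSeed d
    law := ballSeedLaw d
    quant := ballQuant (4 * (r + 2 * δ)) r
    enc := ballEnc (4 * (r + 2 * δ)) r δ
    dec := ballDec (4 * (r + 2 * δ)) (r + δ)
    measurable_quant := measurable_ballQuant _ r
    measurable_enc := measurable_ballEnc _ r δ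
    measurable_dec := measurable_ballDec _ (r + δ)
    norm_quant_sub_le := norm_ballQuant_sub_le hr.le
    integral_quant := integral_ballQuant hL hr.le (by linarith)
    ae_dec_enc := ae_ballDec_ballEnc hL hr hδ hLr
    lintegral_length_enc_le := lintegral_length_ballEnc_le hL hr hδ hLr }

end BallQuantizer

/-! ### Self-delimiting messages -/

/-- A self-delimiting encoding of bit strings. -/
def frame : List Bool → List Bool
  | [] => [false]
  | b :: m => true :: b :: frame m

/-- The first framed message of a string, and the rest of the string. -/
def unframe : List Bool → List Bool × List Bool
  | true :: b :: s => (b :: (unframe s).1, (unframe s).2)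
  | _ :: s => ([], s)
  | [] => ([], [])

/-- The first `k` framed messages of a string. -/
def unframeAll : ℕ → List Bool → List (List Bool)
  | 0, _ => []
  | k + 1, s => (unframe s).1 :: unframeAll k (unframe s).2

theorem length_frame (m : List Bool) : (frame m).length = 2 * m.length + 1 := by
  induction m with
  | nil => rfl
  | cons b m ih => simp only [frame, List.length_cons, ih]; ring

theorem unframe_frame_append (m s : List Bool) : unframe (frame m ++ s) = (m, s) := by
  induction m with
  | nil => simp [frame, unframe]
  | cons b m ih => simp [frame, unframe, ih]

/-- The leader receives a single concatenated string, from which it must separate the messages of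
the `n` senders. -/
theorem unframeAll_flatMap_frame {α : Type*} (f : α → List Bool) (l : List α) :
    unframeAll l.length (l.flatMap fun a => frame (f a)) = l.map f := by
  induction l with
  | nil => rfl
  | cons a l ih => simp [unframeAll, unframe_frame_append, ih]

theorem flatMap_ite_eq {α : Type*} [DecidableEq α] {l : List α} (hl : l.Nodup) {w : α}
    (hw : w ∈ l) (m : List Bool) : (l.flatMap fun u => if u = w then m else []) = m := by
  induction l with
  | nil => simp at hw
  | cons a l ih =>
    rw [List.nodup_cons] at hl
    rw [List.flatMap_cons]
    by_cases h : a = w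
    · subst h
      have h0 : (l.flatMap fun u => if u = a then m else []) = [] := by
        rw [List.flatMap_eq_nil_iff]
        intro u hu
        rw [if_neg]
        rintro rfl
        exact hl.1 hu
      rw [h0, if_pos rfl, List.append_nil]
    · rw [if_neg h, ih hl.2 ((List.mem_cons.1 hw).resolve_left (Ne.symm h)), List.nil_append]

theorem length_flatMap_finRange {n : ℕ} (f : Fin n → List Bool) :
    ((List.finRange n).flatMap f).length = ∑ u, (f u).length := by
  rw [List.length_flatMap, ← List.ofFn_eq_map, List.sum_ofFn]

theorem measurable_flatMap {α β : Type*} [MeasurableSpace α] (l : List β) {f : β → α → List Bool}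
    (hf : ∀ b, Measurable (f b)) : Measurable fun a => l.flatMap fun b => f b a := by
  induction l with
  | nil => exact measurable_const
  | cons b l ih =>
    simp only [List.flatMap_cons]
    exact (Measurable.of_discrete (f := fun p : List Bool × List Bool => p.1 ++ p.2)).comp
      ((hf b).prodMk ih)

theorem norm_mean_le {n : ℕ} {F : Type*} [NormedAddCommGroup F] [NormedSpace ℝ F] (hn : 0 < n)
    {f : Fin n → F} {ε : ℝ} (hf : ∀ u, ‖f u‖ ≤ ε) : ‖(n : ℝ)⁻¹ • ∑ u, f u‖ ≤ ε := by
  have hn' : (0 : ℝ) < n := by exact_mod_cast hn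
  rw [norm_smul, norm_inv, Real.norm_natCast, inv_mul_le_iff₀ hn']
  refine (norm_sum_le _ _).trans ((Finset.sum_le_sum fun u _ => hf u).trans ?_)
  simp

theorem mean_sub {n : ℕ} {F : Type*} [NormedAddCommGroup F] [NormedSpace ℝ F] (hn : 0 < n)
    (f : Fin n → F) (c : F) : (n : ℝ)⁻¹ • ∑ u, f u - c = (n : ℝ)⁻¹ • ∑ u, (f u - c) := by
  have hn' : (n : ℝ) ≠ 0 := by exact_mod_cast hn.ne'
  rw [Finset.sum_sub_distrib, smul_sub, Finset.sum_const, Finset.card_univ, Fintype.card_fin,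
    ← Nat.cast_smul_eq_nsmul ℝ, inv_smul_smul₀ hn']

/-! ### Broadcasting from a random leader -/

/-- One round in which all machines send messages to a leader, who then forms an aggregate. -/
structure Aggregator (n d : ℕ) where
  /-- The space of shared random strings. -/
  Θ : Type
  [measurableSpace : MeasurableSpace Θ]
  /-- The distribution of the shared random string. -/
  law : Measure Θ
  [isProbabilityMeasure : IsProbabilityMeasure law]
  /-- The message of a machine to the leader. -/
  msg : Θ → EuclideanSpace ℝ (Fin d) → List Bool
  /-- The aggregate formed by the leader from its own input and the received string. -/
  agg : Θ → EuclideanSpace ℝ (Fin d) → List Bool → EuclideanSpace ℝ (Fin d)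
  measurable_msg : ∀ a, Measurable fun θ => msg θ a
  measurable_agg : ∀ a s, Measurable fun θ => agg θ a s

attribute [instance] Aggregator.measurableSpace Aggregator.isProbabilityMeasure

namespace Aggregator

variable {n d : ℕ} (A : Aggregator n d)

/-- The string received by the leader. -/
def inbox (θ : A.Θ) (x : Fin n → EuclideanSpace ℝ (Fin d)) : List Bool :=
  (List.finRange n).flatMap fun u => A.msg θ (x u)

/-- The aggregate formed by the leader `w` when the inputs are `x`. -/
def value (θ : A.Θ) (x : Fin n → EuclideanSpace ℝ (Fin d)) (w : Fin n) :
    EuclideanSpace ℝ (Fin d) :=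
  A.agg θ (x w) (A.inbox θ x)

theorem measurable_value (x : Fin n → EuclideanSpace ℝ (Fin d)) (w : Fin n) :
    Measurable fun θ => A.value θ x w :=
  measurable_of_countable_index (f := fun s θ => A.agg θ (x w) s)
    (measurable_flatMap (List.finRange n) fun u => A.measurable_msg (x u)) (A.measurable_agg (x w))

variable {r δ b : ℝ} (Q : Quantizer d r δ b)

section

variable (x : Fin n → EuclideanSpace ℝ (Fin d)) (w : Fin n) (θ : A.Θ × Q.Θ)

/-- The string that the leader sends in the second round. -/
def announcement : List Bool := Q.enc θ.2 (A.value θ.1 x w)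

theorem measurable_quant_value :
    Measurable fun θ : A.Θ × Q.Θ => Q.quant θ.2 (A.value θ.1 x w) :=
  Q.measurable_quant.comp (measurable_snd.prodMk ((A.measurable_value x w).comp measurable_fst))

theorem measurable_announcement : Measurable fun θ : A.Θ × Q.Θ => A.announcement Q x w θ :=
  Q.measurable_enc.comp (measurable_snd.prodMk ((A.measurable_value x w).comp measurable_fst))

end

variable [NeZero n]

/-- The protocol in which a random leader aggregates the inputs and broadcasts a quantization of
the aggregate. -/
noncomputable def broadcast : Protocol n d where
  Ω := Fin n × (A.Θ × Q.Θ)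
  law := (PMF.uniformOfFintype (Fin n)).toMeasure.prod (A.law.prod Q.law)
  rounds := 2
  send t u ω a s v :=
    if t = 0 then if v = ω.1 then A.msg ω.2.1 a else []
    -- The leader does not write to itself, so its final string is still its inbox and it can
    -- recompute the aggregate for its output. Every other machine receives the announcement alone,
    -- whose end therefore needs no marking.
    else if u = ω.1 ∧ v ≠ ω.1 then Q.enc ω.2.2 (A.agg ω.2.1 a s) else []
  output v ω a s :=
    if v = ω.1 then Q.quant ω.2.2 (A.agg ω.2.1 a s) else Q.dec ω.2.2 a s
  measurableSet_send t u a s v m := by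
    refine measurableSet_eq_fun (f := fun ω : Fin n × (A.Θ × Q.Θ) =>
      if t = 0 then if v = ω.1 then A.msg ω.2.1 a else []
      else if u = ω.1 ∧ v ≠ ω.1 then Q.enc ω.2.2 (A.agg ω.2.1 a s) else []) ?_ measurable_const
    refine measurable_from_prod_countable_right fun w => ?_
    have h1 : Measurable fun θ : A.Θ × Q.Θ => A.msg θ.1 a :=
      (A.measurable_msg a).comp measurable_fst
    have h2 : Measurable fun θ : A.Θ × Q.Θ => Q.enc θ.2 (A.agg θ.1 a s) :=
      Q.measurable_enc.comp
        (measurable_snd.prodMk ((A.measurable_agg a s).comp measurable_fst))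
    dsimp only
    split_ifs
    exacts [h1, measurable_const, h2, measurable_const]
  measurable_output v a s := by
    refine measurable_from_prod_countable_right fun w => ?_
    have h1 : Measurable fun θ : A.Θ × Q.Θ => Q.quant θ.2 (A.agg θ.1 a s) :=
      Q.measurable_quant.comp
        (measurable_snd.prodMk ((A.measurable_agg a s).comp measurable_fst))
    have h2 : Measurable fun θ : A.Θ × Q.Θ => Q.dec θ.2 a s :=
      (Q.measurable_dec a s).comp measurable_snd
    dsimp only
    split_ifs
    exacts [h1, h2]

variable (x : Fin n → EuclideanSpace ℝ (Fin d)) (w : Fin n) (θ : A.Θ × Q.Θ) (v : Fin n)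

theorem received_one_broadcast :
    (A.broadcast Q).received x (w, θ) 1 v = if v = w then A.inbox θ.1 x else [] := by
  simp only [Protocol.received, broadcast, List.nil_append, if_true]
  split_ifs
  · rfl
  · simp

theorem received_two_broadcast :
    (A.broadcast Q).received x (w, θ) 2 v
      = if v = w then A.inbox θ.1 x else A.announcement Q x w θ := by
  have h2 : (A.broadcast Q).received x (w, θ) 2 v = (A.broadcast Q).received x (w, θ) 1 v ++
      (List.finRange n).flatMap fun u => (A.broadcast Q).send 1 u (w, θ) (x u)
        ((A.broadcast Q).received x (w, θ) 1 u) v := rfl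
  rw [h2]
  simp only [received_one_broadcast]
  simp only [broadcast, one_ne_zero, if_false]
  by_cases hv : v = w
  · simp [hv]
  · have h : ∀ u, (if u = w ∧ v ≠ w then
        Q.enc θ.2 (A.agg θ.1 (x u) (if u = w then A.inbox θ.1 x else [])) else [])
        = if u = w then A.announcement Q x w θ else [] := by
      intro u
      by_cases hu : u = w
      · subst hu
        simp [hv, announcement, value]
      · simp [hu]
    simp only [h, if_neg hv, List.nil_append]
    exact flatMap_ite_eq (List.nodup_finRange n) (List.mem_finRange w) _

theorem out_broadcast :
    (A.broadcast Q).out x (w, θ) v = if v = w then Q.quant θ.2 (A.value θ.1 x w)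
      else Q.dec θ.2 (x v) (A.announcement Q x w θ) := by
  have h : (A.broadcast Q).out x (w, θ) v
      = (A.broadcast Q).output v (w, θ) (x v) ((A.broadcast Q).received x (w, θ) 2 v) := rfl
  rw [h, received_two_broadcast]
  simp only [broadcast]
  by_cases hv : v = w
  · subst hv
    simp [value]
  · simp [hv]

theorem bits_broadcast_le :
    (A.broadcast Q).bits x (w, θ) v ≤ (A.msg θ.1 (x v)).length
      + (if w = v then n * (A.announcement Q x w θ).length + ∑ u, (A.msg θ.1 (x u)).length else 0)
      + (A.announcement Q x w θ).length := by
  have hb : (A.broadcast Q).bits x (w, θ) v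
      = (∑ u, ((A.broadcast Q).send 0 v (w, θ) (x v) [] u).length
        + ∑ u, ((A.broadcast Q).send 1 v (w, θ) (x v)
          ((A.broadcast Q).received x (w, θ) 1 v) u).length)
        + ((A.broadcast Q).received x (w, θ) 2 v).length := by
    have h2 : (A.broadcast Q).rounds = 2 := rfl
    simp [Protocol.bits, Protocol.sentBits, h2, Finset.sum_range_succ, Protocol.received]
  rw [hb, received_one_broadcast, received_two_broadcast]
  have h0 : ∑ u, ((A.broadcast Q).send 0 v (w, θ) (x v) [] u).length
      = (A.msg θ.1 (x v)).length := by
    simp [broadcast, apply_ite List.length]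
  rw [h0]
  by_cases hv : v = w
  · subst hv
    have h1 : ∑ u, ((A.broadcast Q).send 1 v (v, θ) (x v)
        (if v = v then A.inbox θ.1 x else []) u).length
        ≤ n * (A.announcement Q x v θ).length := by
      refine (Finset.sum_le_card_nsmul _ _ (A.announcement Q x v θ).length fun u _ => ?_).trans ?_
      · simp only [broadcast, one_ne_zero, if_false, if_true, true_and]
        split_ifs
        · exact le_rfl
        · simp
      · simp
    have h2 : (A.inbox θ.1 x).length = ∑ u, (A.msg θ.1 (x u)).length :=
      length_flatMap_finRange _
    rw [if_pos rfl, if_pos rfl, if_pos rfl, ← h2]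
    rw [if_pos rfl] at h1
    omega
  · have h1 : ∀ s, ∑ u, ((A.broadcast Q).send 1 v (w, θ) (x v) s u).length = 0 := by
      intro s
      simp [broadcast, hv]
    rw [h1, if_neg hv, if_neg (Ne.symm hv)]

theorem measurable_out_broadcast :
    Measurable fun ω : Fin n × (A.Θ × Q.Θ) => (A.broadcast Q).out x ω v := by
  refine measurable_from_prod_countable_right fun w => ?_
  simp only [out_broadcast]
  split_ifs
  · exact A.measurable_quant_value Q x w
  · exact measurable_of_countable_index (f := fun m (θ : A.Θ × Q.Θ) => Q.dec θ.2 (x v) m)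
      (A.measurable_announcement Q x w) fun m => (Q.measurable_dec (x v) m).comp measurable_snd

end Aggregator

/-! ### Cost and correctness of the broadcast -/

namespace Aggregator

variable {n d : ℕ} (A : Aggregator n d) {r δ b : ℝ} (Q : Quantizer d r δ b)

section

variable [NeZero n]

theorem toMeasure_uniformOfFintype_singleton (v : Fin n) :
    (PMF.uniformOfFintype (Fin n)).toMeasure {v} = (n : ENNReal)⁻¹ := by
  rw [PMF.toMeasure_apply_singleton _ _ (measurableSet_singleton v)]
  simp

theorem expectedBitsLE_broadcast {y b₁ : ℝ} (hb₁ : 0 ≤ b₁) (hb : 0 ≤ b)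
    (h : ∀ a, ∫⁻ θ, ((A.msg θ a).length : ENNReal) ∂A.law ≤ ENNReal.ofReal b₁) :
    (A.broadcast Q).ExpectedBitsLE y (2 * (b₁ + b)) := by
  intro x _ v
  have hlen : Measurable fun m : List Bool => (m.length : ENNReal) := .of_discrete
  have hmsg : ∀ u, Measurable fun θ : A.Θ × Q.Θ => ((A.msg θ.1 (x u)).length : ENNReal) :=
    fun u => hlen.comp ((A.measurable_msg (x u)).comp measurable_fst)
  have hann : ∀ w, Measurable fun θ : A.Θ × Q.Θ =>
      ((A.announcement Q x w θ).length : ENNReal) :=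
    fun w => hlen.comp (A.measurable_announcement Q x w)
  have imsg : ∀ u, ∫⁻ θ, ((A.msg θ.1 (x u)).length : ENNReal) ∂(A.law.prod Q.law)
      ≤ ENNReal.ofReal b₁ := by
    intro u
    rw [lintegral_prod _ (hmsg u).aemeasurable]
    simpa using h (x u)
  have iann : ∀ w, ∫⁻ θ, ((A.announcement Q x w θ).length : ENNReal) ∂(A.law.prod Q.law)
      ≤ ENNReal.ofReal b := by
    intro w
    rw [lintegral_prod _ (hann w).aemeasurable]
    calc _ ≤ ∫⁻ _, ENNReal.ofReal b ∂A.law :=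
          lintegral_mono fun θ => Q.lintegral_length_enc_le (A.value θ x w)
      _ = _ := by simp
  set G : Fin n × (A.Θ × Q.Θ) → ENNReal := fun ω => (A.msg ω.2.1 (x v)).length
      + (if ω.1 = v then n * (A.announcement Q x ω.1 ω.2).length
          + ∑ u, ((A.msg ω.2.1 (x u)).length : ENNReal) else 0)
      + (A.announcement Q x ω.1 ω.2).length with hG
  have hGw : ∀ w, Measurable fun θ => (if w = v then n * ((A.announcement Q x w θ).length : ENNReal)
          + ∑ u, ((A.msg θ.1 (x u)).length : ENNReal) else 0) := by
    intro w
    split_ifs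
    · exact ((hann w).const_mul _).add (Finset.measurable_sum _ fun u _ => hmsg u)
    · exact measurable_const
  have hGm : Measurable G :=
    measurable_from_prod_countable_right fun w => ((hmsg v).add (hGw w)).add (hann w)
  have hn : (n : ENNReal) ≠ 0 := by exact_mod_cast NeZero.ne n
  calc ∫⁻ ω, ((A.broadcast Q).bits x ω v : ENNReal) ∂(A.broadcast Q).law
      ≤ ∫⁻ ω, G ω ∂((PMF.uniformOfFintype (Fin n)).toMeasure.prod (A.law.prod Q.law)) := by
        refine lintegral_mono fun ω => ?_
        obtain ⟨w, θ⟩ := ω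
        refine (Nat.cast_le.2 (A.bits_broadcast_le Q x w θ v)).trans (le_of_eq ?_)
        simp only [hG]
        push_cast
        rfl
    -- A leader's load of `n` announcements and `n` incoming messages is weighted by the probability
    -- `1/n` of being the leader.
    _ ≤ ∫⁻ w, (ENNReal.ofReal b₁ + ({v} : Set (Fin n)).indicator
          (fun _ => n * (ENNReal.ofReal b + ENNReal.ofReal b₁)) w + ENNReal.ofReal b)
          ∂(PMF.uniformOfFintype (Fin n)).toMeasure := by
        rw [lintegral_prod _ hGm.aemeasurable]
        refine lintegral_mono fun w => ?_
        simp only [hG]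
        rw [lintegral_add_right _ (hann w), lintegral_add_right _ (hGw w)]
        refine add_le_add (add_le_add (imsg v) ?_) (iann w)
        by_cases hw : w = v
        · subst hw
          simp only [if_true, Set.mem_singleton_iff, Set.indicator_of_mem]
          rw [lintegral_add_left ((hann w).const_mul _),
            lintegral_const_mul' _ _ (ENNReal.natCast_ne_top n),
            lintegral_finsetSum _ fun u _ => hmsg u, mul_add]
          refine add_le_add (by gcongr; exact iann w) ?_
          refine (Finset.sum_le_card_nsmul _ _ _ fun u _ => imsg u).trans ?_
          simp
        · simp [hw]
    _ = ENNReal.ofReal b₁ + (ENNReal.ofReal b + ENNReal.ofReal b₁) + ENNReal.ofReal b := by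
        rw [lintegral_add_right _ measurable_const, lintegral_add_left measurable_const,
          lintegral_indicator_const (measurableSet_singleton v),
          toMeasure_uniformOfFintype_singleton, mul_right_comm,
          ENNReal.mul_inv_cancel hn (ENNReal.natCast_ne_top n), one_mul]
        simp
    _ = ENNReal.ofReal (2 * (b₁ + b)) := by
        rw [← ENNReal.ofReal_add hb hb₁, ← ENNReal.ofReal_add hb₁ (by positivity),
          ← ENNReal.ofReal_add (by positivity) hb]
        congr 1
        ring

/-- The aggregates are good estimates of the mean of inputs at pairwise distance at most `y`. -/
structure IsGood (A : Aggregator n d) (y δ ρ : ℝ) : Prop where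
  close : ∀ x : Fin n → EuclideanSpace ℝ (Fin d), (∀ u v, ‖x u - x v‖ ≤ y) → ∀ w,
    ∀ᵐ θ ∂A.law, ∀ v, ‖A.value θ x w - x v‖ ≤ δ
  mean_close : ∀ x : Fin n → EuclideanSpace ℝ (Fin d), (∀ u v, ‖x u - x v‖ ≤ y) → ∀ w,
    ∀ᵐ θ ∂A.law, ‖A.value θ x w - (n : ℝ)⁻¹ • ∑ u, x u‖ ≤ ρ
  mean_integral : ∀ x : Fin n → EuclideanSpace ℝ (Fin d), (∀ u v, ‖x u - x v‖ ≤ y) →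
    (n : ℝ)⁻¹ • ∑ w, ∫ θ, A.value θ x w ∂A.law = (n : ℝ)⁻¹ • ∑ u, x u

variable {A}

theorem ae_out_broadcast {y ρ : ℝ} (hA : A.IsGood y δ ρ) {x : Fin n → EuclideanSpace ℝ (Fin d)}
    (hx : ∀ u v, ‖x u - x v‖ ≤ y) :
    ∀ᵐ ω ∂(A.broadcast Q).law, ∀ v,
      (A.broadcast Q).out x ω v = Q.quant ω.2.2 (A.value ω.2.1 x ω.1) := by
  have hq : Measurable fun ω : Fin n × (A.Θ × Q.Θ) => Q.quant ω.2.2 (A.value ω.2.1 x ω.1) :=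
    measurable_from_prod_countable_right fun w => A.measurable_quant_value Q x w
  refine ae_all_iff.2 fun v => ?_
  refine (Measure.ae_prod_iff_ae_ae
    (measurableSet_eq_fun (A.measurable_out_broadcast Q x v) hq)).2
    (Filter.Eventually.of_forall fun w => ?_)
  refine (Measure.ae_prod_iff_ae_ae (measurableSet_eq_fun
    ((A.measurable_out_broadcast Q x v).comp measurable_prodMk_left)
    (hq.comp measurable_prodMk_left))).2 ?_
  filter_upwards [hA.close x hx w] with θ₁ h1
  filter_upwards [Q.ae_dec_enc (A.value θ₁ x w)] with θ₂ h2
  refine (out_broadcast A Q x w (θ₁, θ₂) v).trans ?_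
  split_ifs
  · rfl
  · exact h2 (x v) (h1 v)

/-- The error is almost surely at most `r + ρ`, which bounds the variance. For the mean, the
quantizer is integrated out first, its seed being independent of the aggregate; what remains is the
average over leaders in `mean_integral`. -/
theorem performsMeanEstimation_broadcast {y ρ : ℝ} (hA : A.IsGood y δ ρ) :
    (A.broadcast Q).PerformsMeanEstimation y ((r + ρ) ^ 2) := by
  intro x hx
  have hout := ae_out_broadcast Q hA hx
  set μ := (n : ℝ)⁻¹ • ∑ u, x u with hμ
  have hq : Measurable fun ω : Fin n × (A.Θ × Q.Θ) => Q.quant ω.2.2 (A.value ω.2.1 x ω.1) :=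
    measurable_from_prod_countable_right fun w => A.measurable_quant_value Q x w
  have hbound : ∀ᵐ ω ∂((PMF.uniformOfFintype (Fin n)).toMeasure.prod (A.law.prod Q.law)),
      ‖Q.quant ω.2.2 (A.value ω.2.1 x ω.1) - μ‖ ≤ r + ρ := by
    refine (Measure.ae_prod_iff_ae_ae (measurableSet_le (hq.sub_const μ).norm
      measurable_const)).2 (Filter.Eventually.of_forall fun w => ?_)
    filter_upwards [Measure.quasiMeasurePreserving_fst.ae (hA.mean_close x hx w)] with θ h
    calc _ = ‖(Q.quant θ.2 (A.value θ.1 x w) - A.value θ.1 x w) + (A.value θ.1 x w - μ)‖ := by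
          rw [sub_add_sub_cancel]
      _ ≤ r + ρ := (norm_add_le _ _).trans (add_le_add (Q.norm_quant_sub_le _ _) h)
  have hint : Integrable (fun ω : Fin n × (A.Θ × Q.Θ) => Q.quant ω.2.2 (A.value ω.2.1 x ω.1))
      ((PMF.uniformOfFintype (Fin n)).toMeasure.prod (A.law.prod Q.law)) := by
    have h1 := (Integrable.of_bound (hq.sub_const μ).aestronglyMeasurable _ hbound).add
      (integrable_const μ)
    refine h1.congr (Filter.Eventually.of_forall fun ω => ?_)
    simp
  have hw : ∀ w, Integrable (fun θ : A.Θ × Q.Θ => Q.quant θ.2 (A.value θ.1 x w))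
      (A.law.prod Q.law) := by
    intro w
    have hb : ∀ᵐ θ ∂(A.law.prod Q.law), ‖Q.quant θ.2 (A.value θ.1 x w)‖ ≤ r + ρ + ‖μ‖ := by
      filter_upwards [Measure.quasiMeasurePreserving_fst.ae (hA.mean_close x hx w)] with θ h
      calc _ = ‖(Q.quant θ.2 (A.value θ.1 x w) - A.value θ.1 x w)
            + (A.value θ.1 x w - μ) + μ‖ := by
            rw [sub_add_sub_cancel, sub_add_cancel]
        _ ≤ r + ρ + ‖μ‖ := (norm_add_le _ _).trans (add_le_add_left
            ((norm_add_le _ _).trans (add_le_add (Q.norm_quant_sub_le _ _) h)) _)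
    exact Integrable.of_bound (A.measurable_quant_value Q x w).aestronglyMeasurable _ hb
  have hmean : ∫ ω, Q.quant ω.2.2 (A.value ω.2.1 x ω.1)
      ∂((PMF.uniformOfFintype (Fin n)).toMeasure.prod (A.law.prod Q.law)) = μ := by
    rw [integral_prod _ hint]
    have h1 : ∀ w, ∫ θ, Q.quant θ.2 (A.value θ.1 x w) ∂(A.law.prod Q.law)
        = ∫ θ, A.value θ x w ∂A.law := by
      intro w
      rw [integral_prod _ (hw w)]
      simp only [Q.integral_quant]
    simp only [h1]
    rw [PMF.integral_eq_sum, hμ, ← hA.mean_integral x hx, Finset.smul_sum]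
    simp
  refine ⟨hout.mono fun ω h u v => (h u).trans (h v).symm, fun v => ?_⟩
  have hv : (fun ω => (A.broadcast Q).out x ω v) =ᵐ[(A.broadcast Q).law]
      fun ω => Q.quant ω.2.2 (A.value ω.2.1 x ω.1) := hout.mono fun ω h => h v
  refine ⟨hint.congr hv.symm, (integral_congr_ae hv).trans hmean, ?_⟩
  have hb : ∀ᵐ ω ∂(A.broadcast Q).law,
      ‖(A.broadcast Q).out x ω v - μ‖ₑ ^ 2 ≤ ENNReal.ofReal ((r + ρ) ^ 2) := by
    have hbound' : ∀ᵐ ω ∂(A.broadcast Q).law,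
      ‖Q.quant ω.2.2 (A.value ω.2.1 x ω.1) - μ‖ ≤ r + ρ := hbound
    filter_upwards [hv, hbound'] with ω h1 h2
    rw [h1, ← ofReal_norm, ← ENNReal.ofReal_pow (norm_nonneg _)]
    exact ENNReal.ofReal_le_ofReal (pow_le_pow_left₀ (norm_nonneg _) h2 2)
  refine (lintegral_mono_ae hb).trans ?_
  simp

end

/-! ### The two aggregators -/

/-- The leader takes its own input as the aggregate; no messages are sent. -/
noncomputable def ofLeader (n d : ℕ) : Aggregator n d where
  Θ := Unit
  law := Measure.dirac ()
  msg _ _ := []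
  agg _ a _ := a
  measurable_msg _ := measurable_const
  measurable_agg _ _ := measurable_const

theorem isGood_ofLeader (n d : ℕ) [NeZero n] (y : ℝ) : (ofLeader n d).IsGood y y y where
  close x hx w := Filter.Eventually.of_forall fun _ => hx w
  mean_close x hx w := Filter.Eventually.of_forall fun θ => by
    have h : (ofLeader n d).value θ x w = x w := rfl
    rw [norm_sub_rev, h, mean_sub (NeZero.pos n)]
    exact norm_mean_le (NeZero.pos n) fun u => hx u w
  mean_integral x _ := by
    have h : ∀ θ w, (ofLeader n d).value θ x w = x w := fun _ _ => rfl
    simp [h]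

/-- All machines send quantizations of their inputs to the leader, who takes the average. -/
noncomputable def ofQuantizer (n : ℕ) : Aggregator n d where
  Θ := Q.Θ
  law := Q.law
  msg θ a := frame (Q.enc θ a)
  agg θ a s := (n : ℝ)⁻¹ • ((unframeAll n s).map (Q.dec θ a)).sum
  measurable_msg a := (Measurable.of_discrete (f := frame)).comp
    (Q.measurable_enc.comp measurable_prodMk_right)
  measurable_agg a s := by
    have h : ∀ l : List (List Bool), Measurable fun θ => (l.map (Q.dec θ a)).sum := by
      intro l
      induction l with
      | nil => exact measurable_const
      | cons m l ih =>
        simp only [List.map_cons, List.sum_cons]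
        exact (Q.measurable_dec a m).add ih
    exact (h _).const_smul (n : ℝ)⁻¹

theorem ae_value_ofQuantizer {x : Fin n → EuclideanSpace ℝ (Fin d)}
    (hx : ∀ u v, ‖x u - x v‖ ≤ δ) (w : Fin n) :
    ∀ᵐ θ ∂Q.law, (ofQuantizer Q n).value θ x w = (n : ℝ)⁻¹ • ∑ u, Q.quant θ (x u) := by
  filter_upwards [ae_all_iff.2 fun u => Q.ae_dec_enc (x u)] with θ h
  have h1 : unframeAll n ((ofQuantizer Q n).inbox θ x)
      = (List.finRange n).map fun u => Q.enc θ (x u) := by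
    have := unframeAll_flatMap_frame (fun u => Q.enc θ (x u)) (List.finRange n)
    rwa [List.length_finRange] at this
  have h2 : (ofQuantizer Q n).value θ x w = (n : ℝ)⁻¹ •
      ((unframeAll n ((ofQuantizer Q n).inbox θ x)).map (Q.dec θ (x w))).sum := rfl
  rw [h2, h1, List.map_map, ← List.ofFn_eq_map, List.sum_ofFn]
  congr 1
  exact Finset.sum_congr rfl fun u _ => h u (x w) (hx u w)

/-- All machines share one seed, so their errors are correlated; the triangle inequality alone keeps
the average within `r` of the mean. -/
theorem isGood_ofQuantizer [NeZero n] : (ofQuantizer Q n).IsGood δ (r + δ) r where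
  close x hx w := by
    filter_upwards [ae_value_ofQuantizer Q hx w] with θ h v
    rw [h, mean_sub (NeZero.pos n)]
    refine norm_mean_le (NeZero.pos n) fun u => ?_
    rw [← sub_add_sub_cancel _ (x u)]
    exact (norm_add_le _ _).trans (add_le_add (Q.norm_quant_sub_le _ _) (hx u v))
  mean_close x hx w := by
    filter_upwards [ae_value_ofQuantizer Q hx w] with θ h
    rw [h, ← smul_sub, ← Finset.sum_sub_distrib]
    exact norm_mean_le (NeZero.pos n) fun u => Q.norm_quant_sub_le _ _
  mean_integral x hx := by
    have hi : ∀ u, Integrable (fun θ => Q.quant θ (x u)) Q.law := by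
      intro u
      refine Integrable.of_bound
        (Q.measurable_quant.comp measurable_prodMk_right).aestronglyMeasurable (r + ‖x u‖)
        (Filter.Eventually.of_forall fun θ => ?_)
      have h := norm_add_le (Q.quant θ (x u) - x u) (x u)
      rw [sub_add_cancel] at h
      exact h.trans (add_le_add_left (Q.norm_quant_sub_le _ _) _)
    have h : ∀ w, ∫ θ, (ofQuantizer Q n).value θ x w ∂(ofQuantizer Q n).law
        = (n : ℝ)⁻¹ • ∑ u, x u := by
      intro w
      have h' : ∫ θ, (n : ℝ)⁻¹ • ∑ u, Q.quant θ (x u) ∂Q.law = (n : ℝ)⁻¹ • ∑ u, x u := by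
        rw [integral_smul, integral_finsetSum _ fun u _ => hi u]
        simp only [Q.integral_quant]
      exact (integral_congr_ae (ae_value_ofQuantizer Q hx w)).trans h'
    have hn : (n : ℝ) ≠ 0 := by exact_mod_cast NeZero.ne n
    simp only [h, Finset.sum_const, Finset.card_univ, Fintype.card_fin]
    rw [← Nat.cast_smul_eq_nsmul ℝ, inv_smul_smul₀ hn]

theorem lintegral_length_msg_ofQuantizer (hb : 0 ≤ b) (a : EuclideanSpace ℝ (Fin d)) :
    ∫⁻ θ, (((ofQuantizer Q n).msg θ a).length : ENNReal) ∂(ofQuantizer Q n).law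
      ≤ ENNReal.ofReal (2 * b + 1) := by
  calc _ = ∫⁻ θ, (2 * ((Q.enc θ a).length : ENNReal) + 1) ∂Q.law := by
        refine lintegral_congr fun θ => ?_
        have h : ((ofQuantizer Q n).msg θ a).length = 2 * (Q.enc θ a).length + 1 :=
          length_frame _
        rw [h]
        push_cast
        rfl
    _ = 2 * ∫⁻ θ, ((Q.enc θ a).length : ENNReal) ∂Q.law + 1 := by
        rw [lintegral_add_right _ measurable_const, lintegral_const_mul' _ _ ENNReal.ofNat_ne_top]
        simp
    _ ≤ 2 * ENNReal.ofReal b + 1 := by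
        gcongr
        exact Q.lintegral_length_enc_le a
    _ = ENNReal.ofReal (2 * b + 1) := by
        rw [ENNReal.ofReal_add (by positivity) zero_le_one, ENNReal.ofReal_mul zero_le_two]
        simp

end Aggregator

/-! ### The theorem -/

theorem Protocol.ExpectedBitsLE.mono {n d : ℕ} {P : Protocol n d} {y b b' : ℝ}
    (h : P.ExpectedBitsLE y b) (hb : b ≤ b') : P.ExpectedBitsLE y b' :=
  fun x hx v => (h x hx v).trans (ENNReal.ofReal_le_ofReal hb)

theorem Protocol.PerformsMeanEstimation.mono {n d : ℕ} {P : Protocol n d} {y V V' : ℝ}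
    (h : P.PerformsMeanEstimation y V) (hV : V ≤ V') : P.PerformsMeanEstimation y V' :=
  fun x hx => ⟨(h x hx).1, fun v => ⟨((h x hx).2 v).1, ((h x hx).2 v).2.1,
    ((h x hx).2 v).2.2.trans (ENNReal.ofReal_le_ofReal hV)⟩⟩

/-- The protocol in which all machines output their own inputs without any communication. -/
noncomputable def Protocol.silent (n d : ℕ) : Protocol n d where
  Ω := Unit
  law := Measure.dirac ()
  rounds := 0
  send _ _ _ _ _ _ := []
  output _ _ a _ := a
  measurableSet_send _ _ _ _ _ _ := MeasurableSet.of_discrete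
  measurable_output _ _ _ := measurable_const

theorem Protocol.performsMeanEstimation_silent {n d : ℕ} (hn : 0 < n) {y V : ℝ}
    (h : ∀ x : Fin n → EuclideanSpace ℝ (Fin d), (∀ u v, ‖x u - x v‖ ≤ y) → ∀ u v, x u = x v) :
    (Protocol.silent n d).PerformsMeanEstimation y V := by
  intro x hx
  have hout : ∀ ω v, (Protocol.silent n d).out x ω v = x v := fun _ _ => rfl
  have hmean : ∀ v, (n : ℝ)⁻¹ • ∑ u, x u = x v := by
    intro v
    rw [← sub_eq_zero, mean_sub hn]
    simp [fun u => h x hx u v]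
  refine ⟨Filter.Eventually.of_forall fun ω u v => h x hx u v, fun v => ?_⟩
  simp only [hout, hmean v]
  exact ⟨integrable_const _, by simp, by simp⟩

theorem Protocol.expectedBitsLE_silent {n d : ℕ} {y b : ℝ} :
    (Protocol.silent n d).ExpectedBitsLE y b := by
  intro x _ v
  have h : ∀ ω, (Protocol.silent n d).bits x ω v = 0 := fun _ => rfl
  simp [h]

/-- Bernoulli's inequality, used to absorb constant factors in front of `q`. -/
theorem logb_two_one_add_mul_le {q : ℝ} (hq : 0 < q) (k : ℕ) :
    Real.logb 2 (1 + k * q) ≤ k * Real.logb 2 (1 + q) := by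
  rw [← Real.logb_pow]
  exact Real.logb_le_logb_of_le one_lt_two (by positivity)
    (one_add_mul_le_pow (by linarith) k)

theorem logb_two_one_add_le {q : ℝ} (hq : 0 < q) : Real.logb 2 (1 + q) ≤ 2 * q := by
  have h1 : Real.log (1 + q) ≤ q := by
    have := Real.log_le_sub_one_of_pos (x := 1 + q) (by linarith)
    linarith
  have h2 := Real.log_two_gt_d9
  rw [Real.logb, div_le_iff₀ (Real.log_pos one_lt_two)]
  nlinarith

theorem exists_protocol {n d : ℕ} {q y : ℝ} (hn : 0 < n) (hq : 0 < q) (hy : 0 ≤ y) :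
    ∃ P : Protocol n d, P.PerformsMeanEstimation y (4 * (y ^ 2 / q ^ 2)) ∧
      P.ExpectedBitsLE y (100 * (d * Real.logb 2 (1 + q))) := by
  have : NeZero n := ⟨hn.ne'⟩
  -- For `y = 0` the radius `y / q` would vanish; for `d = 0` no bit may be spent, not even on
  -- framing. In both cases all inputs coincide.
  rcases hy.eq_or_lt with rfl | hy
  · exact ⟨Protocol.silent n d, Protocol.performsMeanEstimation_silent hn fun x hx u v =>
      sub_eq_zero.1 (norm_le_zero_iff.1 (hx u v)), Protocol.expectedBitsLE_silent⟩
  rcases Nat.eq_zero_or_pos d with rfl | hd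
  · exact ⟨Protocol.silent n 0, Protocol.performsMeanEstimation_silent hn fun x _ u v =>
      Subsingleton.elim _ _, Protocol.expectedBitsLE_silent⟩
  have hr : 0 < y / q := by positivity
  have hlog : 0 ≤ Real.logb 2 (1 + q) := Real.logb_nonneg one_lt_two (by linarith)
  have hd' : (1 : ℝ) ≤ d := by exact_mod_cast hd
  have hdlog : 0 ≤ d * Real.logb 2 (1 + q) := by positivity
  have hV : 4 * (y ^ 2 / q ^ 2) = (y / q + y / q) ^ 2 := by
    rw [← two_mul, mul_pow, div_pow]
    norm_num
  have hcost : ∀ (k : ℕ) {t : ℝ}, 0 ≤ t → t ≤ k * q →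
      4 * (d * Real.logb 2 (1 + t)) ≤ 4 * (k * (d * Real.logb 2 (1 + q))) := by
    intro k t ht0 ht
    have h1 : Real.logb 2 (1 + t) ≤ k * Real.logb 2 (1 + q) :=
      (Real.logb_le_logb_of_le one_lt_two (by linarith) (by linarith)).trans
        (logb_two_one_add_mul_le hq k)
    have h2 := mul_le_mul_of_nonneg_left h1 (by linarith : (0 : ℝ) ≤ d)
    linarith
  have hpos : ∀ {t : ℝ}, 0 ≤ t → 0 ≤ 4 * (d * Real.logb 2 (1 + t)) := fun ht =>
    mul_nonneg (by norm_num) (mul_nonneg (by linarith)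
      (Real.logb_nonneg one_lt_two (by linarith)))
  have ht1 : 2 * y / (y / q) = 2 * q := by field_simp
  rcases le_or_gt q 1 with hq1 | hq1
  · refine ⟨(Aggregator.ofLeader n d).broadcast (ballQuantizer d hr hy.le), ?_, ?_⟩
    · refine (Aggregator.performsMeanEstimation_broadcast _
        (Aggregator.isGood_ofLeader n d y)).mono ?_
      rw [hV]
      have : y ≤ y / q := by rw [le_div_iff₀ hq]; nlinarith
      gcongr
    · refine (Aggregator.expectedBitsLE_broadcast _ _ (b₁ := 0) le_rfl
        (hpos (by positivity)) fun a => ?_).mono ?_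
      · have h0 : ∀ θ, (((Aggregator.ofLeader n d).msg θ a).length : ENNReal) = 0 :=
          fun _ => Nat.cast_zero
        simp only [h0, lintegral_zero, zero_le]
      · have := hcost 2 (t := 2 * y / (y / q)) (by positivity) (by rw [ht1]; norm_num)
        push_cast at this
        linarith
  · have hδ : 0 ≤ y / q + y := by positivity
    -- The average of the quantized inputs is within `y / q + y` of every input. The resulting `2 +
    -- 2 * q` is at most `4 * q` because `q > 1`.
    have ht2 : 2 * (y / q + y) / (y / q) = 2 + 2 * q := by field_simp
    refine ⟨(Aggregator.ofQuantizer (ballQuantizer d hr hy.le) n).broadcast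
      (ballQuantizer d hr hδ), ?_, ?_⟩
    · rw [hV]
      exact Aggregator.performsMeanEstimation_broadcast _ (Aggregator.isGood_ofQuantizer _)
    · have h1 := hpos (t := 2 * y / (y / q)) (by positivity)
      refine (Aggregator.expectedBitsLE_broadcast _ _ (by linarith) (hpos (by positivity))
        (Aggregator.lintegral_length_msg_ofQuantizer _ h1)).mono ?_
      have h2 := hcost 2 (t := 2 * y / (y / q)) (by positivity) (by rw [ht1]; norm_num)
      have h3 := hcost 4 (t := 2 * (y / q + y) / (y / q)) (by positivity)
        (by rw [ht2]; push_cast; linarith)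
      have h4 : 1 ≤ d * Real.logb 2 (1 + q) := by
        have : 1 ≤ Real.logb 2 (1 + q) := by
          rw [Real.le_logb_iff_rpow_le one_lt_two (by linarith)]
          norm_num
          linarith
        nlinarith
      push_cast at h2 h3
      linarith

theorem theorem9 :
    ∃ C : ℝ, 0 < C ∧
      ∀ (n d : ℕ) (q y : ℝ), 0 < n → 0 < q → 0 ≤ y →
        ∃ P : Protocol n d,
          P.PerformsMeanEstimation y (C * (y ^ 2 / q ^ 2)) ∧
          P.ExpectedBitsLE y (C * (d * Real.logb 2 (1 + q))) ∧
          P.ExpectedBitsLE y (C * (d * q)) := by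
  -- The `100` of `exists_protocol` times the `2` of `logb_two_one_add_le`.
  refine ⟨200, by norm_num, fun n d q y hn hq hy => ?_⟩
  obtain ⟨P, h1, h2⟩ := exists_protocol (d := d) hn hq hy
  have hlog : 0 ≤ Real.logb 2 (1 + q) := Real.logb_nonneg one_lt_two (by linarith)
  have hd : (0 : ℝ) ≤ d := Nat.cast_nonneg d
  have hle := mul_le_mul_of_nonneg_left (logb_two_one_add_le hq) hd
  have h0 : 0 ≤ d * Real.logb 2 (1 + q) := mul_nonneg hd hlog
  refine ⟨P, h1.mono ?_, h2.mono ?_, h2.mono ?_⟩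
  · have : 0 ≤ y ^ 2 / q ^ 2 := by positivity
    linarith
  · linarith
  · linarith
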